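/- Let $f\in\mathbb{Z}[x,z]$ be a homogeneous polynomial of degree $5$ that is irreducible over $\mathbb{Q}$ (in particular, $f$ may be any homogeneous polynomial of degree $5$ that is irreducible in $\mathbb{Z}[x,z]$). For a positive integer $N$, let \[\delta(N) = \#\{(x,z)\in \mathbb{Z}^2 : |x|, |z|\leq N,\ \gcd(x,z)=1,\ p^2 \mid f(x,z) \text{ for some prime } p>N\}.\] Then for every $\epsilon>0$ there is a constant $C$, depending only on $f$ and $\epsilon$, such that \[\delta(N) \leq C\, N^{(5+\sqrt{113})/8 + \epsilon}\] for every integer $N\geq 1$. -/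

import Mathlib

/-- The coprime pairs of integers `(x, z)` with `|x|, |z| ≤ N` such that `p ^ 2 ∣ f(x, z)` for
some prime `p > N`. The two variables of `f` are indexed by `Fin 2`. -/
def largeSquareDivisorPairs (f : MvPolynomial (Fin 2) ℤ) (N : ℕ) : Set (ℤ × ℤ) :=
  {q | |q.1| ≤ (N : ℤ) ∧ |q.2| ≤ (N : ℤ) ∧ Int.gcd q.1 q.2 = 1 ∧
    ∃ p : ℕ, p.Prime ∧ N < p ∧ (p : ℤ) ^ 2 ∣ MvPolynomial.eval ![q.1, q.2] f}

/-- The set is finite, so its `Set.ncard` is its true cardinality. -/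
theorem largeSquareDivisorPairs_finite (f : MvPolynomial (Fin 2) ℤ) (N : ℕ) :
    (largeSquareDivisorPairs f N).Finite := by
  refine ((Set.finite_Icc (-(N : ℤ)) N).prod (Set.finite_Icc (-(N : ℤ)) N)).subset ?_
  rintro ⟨x, z⟩ ⟨hx, hz, -⟩
  exact ⟨abs_le.mp hx, abs_le.mp hz⟩

/-- The number `δ(N)` of such pairs. -/
noncomputable def largeSquareDivisorCount (f : MvPolynomial (Fin 2) ℤ) (N : ℕ) : ℕ :=
  (largeSquareDivisorPairs f N).ncard

/-! Put y = N^(1/40). For large N the bound obtained is O(y^78) = O(N^(39/20)), and 39/20 lies just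
below (5 + √113)/8. No ε is lost, since divisor-type factors are absorbed into powers of y.

Primes N < p ≤ y^76. Once N is large, such p divide neither the leading coefficient of the
dehomogenised quintic F nor the integer D of a Bézout relation between F and F', so zeros of the
form modulo p are simple. By Hensel uniqueness (`sq_dvd_cross`), two counted points in the same
projective class modulo p have determinant divisible by p². This determinant is at most 2N² < 2p² in
size, which leaves at most nine points per class (`card_le_nine`). Each prime therefore accounts for
O(1) points, in total O(y^76).

Primes p > y^76. The value is O(y^200), so it equals ±d t² with d squarefree and d = O(y^48). For
fixed d the points lie in at most c^ω(d) lattices of determinant d. On each lattice, in coordinates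
of a reduced basis, a square sieve with R primes up to Q is applied (`square_sieve`). Its complete
character sums modulo pq vanish because the degree is odd: scaling both variables by t of Jacobi
symbol -1 reverses the sign. Only edge effects remain, and one lattice contributes O(N²/(dR) +
Q²N/|b|), with b the shorter basis vector. Summing over d, the first term costs a logarithm. For the
second, d divides the form at b, so each b serves few d, and the sum of 1/|b| over |b|² ≤ 2D', where
D' bounds d, is O(√D'). With R ≥ y^4 and Q ≤ y^6 both terms are O(y^78). -/

open Polynomial

/-! ### Dehomogenisation of the form; simple roots. -/

/-- The binary quintic form `∑ aᵢ xⁱ z⁵⁻ⁱ` attached to the coefficients of `F`. -/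
def quinticForm (F : ℤ[X]) (x z : ℤ) : ℤ :=
  F.coeff 0 * z ^ 5 + F.coeff 1 * x * z ^ 4 + F.coeff 2 * x ^ 2 * z ^ 3 +
    F.coeff 3 * x ^ 3 * z ^ 2 + F.coeff 4 * x ^ 4 * z + F.coeff 5 * x ^ 5

namespace MvPolynomial

theorem IsHomogeneous.not_isUnit {σ R : Type*} [CommSemiring R] [Nontrivial R]
    {p : MvPolynomial σ R} {n : ℕ} (hp : p.IsHomogeneous n) (hn : n ≠ 0) : ¬ IsUnit p := by
  intro h
  have h1 := h.map (constantCoeff (R := R) (σ := σ))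
  rw [constantCoeff_eq, hp.coeff_eq_zero (by simpa using hn.symm)] at h1
  exact not_isUnit_zero h1

end MvPolynomial

theorem eval_homogenize_five (F : ℤ[X]) (x z : ℤ) :
    MvPolynomial.eval ![x, z] (F.homogenize 5) = quinticForm F x z := by
  simp only [homogenize, Finset.Nat.sum_antidiagonal_eq_sum_range_succ_mk, Finset.sum_range_succ,
    Finset.sum_range_zero, MvPolynomial.eval_monomial, map_add]
  simp [Finsupp.prod_fintype, quinticForm]
  ring

/-- A drop in degree would split off a factor z, which is the degree-1 homogenisation of the
constant 1. -/
theorem natDegree_eq_of_irreducible_homogenize {K : Type*} [Field K] {F : K[X]} {n : ℕ}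
    (hn : 2 ≤ n) (hF : F.natDegree ≤ n) (hirr : Irreducible (F.homogenize n)) :
    F.natDegree = n := by
  by_contra hne
  have h1 : F.natDegree ≤ n - 1 := by omega
  have h2 : F.homogenize n = F.homogenize (n - 1) * (1 : K[X]).homogenize 1 := by
    rw [← homogenize_mul F 1 h1 (by simp), mul_one, Nat.sub_add_cancel (by omega)]
  rcases hirr.isUnit_or_isUnit h2 with h | h
  · exact (isHomogeneous_homogenize F).not_isUnit (by omega) h
  · exact (isHomogeneous_homogenize (1 : K[X])).not_isUnit one_ne_zero h

theorem irreducible_of_irreducible_homogenize {K : Type*} [Field K] {F : K[X]} {n : ℕ}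
    (hn : 2 ≤ n) (hF : F.natDegree ≤ n) (hirr : Irreducible (F.homogenize n)) :
    Irreducible F := by
  have hdeg := natDegree_eq_of_irreducible_homogenize hn hF hirr
  have hF0 : F ≠ 0 := by rintro rfl; simp at hdeg; omega
  refine ⟨fun h => by have := natDegree_eq_zero_of_isUnit h; omega, fun G H hGH => ?_⟩
  have hG0 : G ≠ 0 := by rintro rfl; simp [hF0] at hGH
  have hH0 : H ≠ 0 := by rintro rfl; simp [hF0] at hGH
  have hsum : G.natDegree + H.natDegree = n := by rw [← natDegree_mul hG0 hH0, ← hGH, hdeg]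
  have h2 : F.homogenize n = G.homogenize G.natDegree * H.homogenize H.natDegree := by
    rw [← homogenize_mul G H le_rfl le_rfl, ← hGH, hsum]
  rcases hirr.isUnit_or_isUnit h2 with h | h
  · left
    have : G.natDegree = 0 := by
      by_contra h0; exact (isHomogeneous_homogenize G).not_isUnit h0 h
    obtain ⟨c, rfl⟩ := natDegree_eq_zero.mp this
    exact isUnit_C.mpr (by simpa using hG0)
  · right
    have : H.natDegree = 0 := by
      by_contra h0; exact (isHomogeneous_homogenize H).not_isUnit h0 h
    obtain ⟨c, rfl⟩ := natDegree_eq_zero.mp this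
    exact isUnit_C.mpr (by simpa using hH0)

theorem exists_irreducible_quintic (f : MvPolynomial (Fin 2) ℤ) (hf : f.IsHomogeneous 5)
    (hirr : Irreducible (MvPolynomial.map (Int.castRingHom ℚ) f)) :
    ∃ F : ℤ[X], F.natDegree = 5 ∧ Irreducible (F.map (Int.castRingHom ℚ)) ∧
      ∀ x z, MvPolynomial.eval ![x, z] f = quinticForm F x z := by
  set F : ℤ[X] := MvPolynomial.aeval ![X, 1] f with hF
  have h1 : F.homogenize 5 = f := homogenize_eq_of_isHomogeneous hf hF.symm
  have hdegle : F.natDegree ≤ 5 := by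
    rw [natDegree_le_iff_coeff_eq_zero]
    intro m hm
    rw [hF, MvPolynomial.aeval_def, MvPolynomial.eval₂_eq', finsetSum_coeff]
    refine Finset.sum_eq_zero fun d hd => ?_
    have : d 0 + d 1 = 5 := by
      have := hf (MvPolynomial.mem_support_iff.mp hd)
      simpa [Finsupp.weight_apply, Finsupp.sum_fintype] using this
    simp [Fin.prod_univ_two, coeff_X_pow]
    intro h; omega
  have h2 : (F.map (Int.castRingHom ℚ)).homogenize 5 = MvPolynomial.map (Int.castRingHom ℚ) f := by
    rw [homogenize_map, h1]
  have hdegle' : (F.map (Int.castRingHom ℚ)).natDegree ≤ 5 := natDegree_map_le.trans hdegle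
  rw [← h2] at hirr
  refine ⟨F, ?_, irreducible_of_irreducible_homogenize (by norm_num) hdegle' hirr, fun x z => ?_⟩
  · rw [← natDegree_map_eq_of_injective (RingHom.injective_int (Int.castRingHom ℚ)) F]
    exact natDegree_eq_of_irreducible_homogenize (by norm_num) hdegle' hirr
  · rw [← h1, eval_homogenize_five]

theorem eval_eq_six {R : Type*} [CommRing R] (φ : ℤ →+* R) {F : ℤ[X]} (hF : F.natDegree = 5)
    (r : R) : F.eval₂ φ r = φ (F.coeff 0) + φ (F.coeff 1) * r + φ (F.coeff 2) * r ^ 2 +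
      φ (F.coeff 3) * r ^ 3 + φ (F.coeff 4) * r ^ 4 + φ (F.coeff 5) * r ^ 5 := by
  rw [eval₂_eq_sum_range, hF]
  simp [Finset.sum_range_succ]

theorem quinticForm_cast {K : Type*} [Field K] {F : ℤ[X]} (hF : F.natDegree = 5) (x z : ℤ)
    (hz : (z : K) ≠ 0) :
    ((quinticForm F x z : ℤ) : K) = z ^ 5 * F.eval₂ (Int.castRingHom K) (x / z : K) := by
  rw [eval_eq_six _ hF, quinticForm]
  push_cast
  simp only [eq_intCast]
  field_simp

/-- For z ≠ 0 a zero gives the rational root x / z, hence a linear factor; for z = 0 only the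
leading coefficient matters. -/
theorem quinticForm_ne_zero {F : ℤ[X]} (hF : F.natDegree = 5)
    (hirr : Irreducible (F.map (Int.castRingHom ℚ))) {x z : ℤ} (h : x ≠ 0 ∨ z ≠ 0) :
    quinticForm F x z ≠ 0 := by
  intro h0
  by_cases hz : z = 0
  · subst hz
    have hx : x ≠ 0 := by simpa using h
    have : F.coeff 5 ≠ 0 := by
      rw [← hF]; exact leadingCoeff_ne_zero.mpr (by rintro rfl; simp at hF)
    simp [quinticForm, this, hx] at h0
  · have hz' : (z : ℚ) ≠ 0 := by exact_mod_cast hz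
    have h1 := quinticForm_cast (K := ℚ) hF x z hz'
    rw [h0] at h1
    have h2 : (F.map (Int.castRingHom ℚ)).IsRoot (x / z : ℚ) := by
      rw [IsRoot, eval_map]
      simpa [hz'] using h1.symm
    have h3 := degree_eq_one_of_irreducible_of_root hirr h2
    have h4 := natDegree_eq_of_degree_eq_some (n := 1) h3
    rw [natDegree_map_eq_of_injective (RingHom.injective_int (Int.castRingHom ℚ))] at h4
    omega

/-- D is the resultant of F and F', nonzero because irreducible polynomials over ℚ are separable. A
prime not dividing D sees no double root of F. -/
theorem exists_bezout_derivative {F : ℤ[X]} (hF : F.natDegree = 5)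
    (hirr : Irreducible (F.map (Int.castRingHom ℚ))) :
    ∃ D : ℤ, D ≠ 0 ∧ ∃ A B : ℤ[X], F * A + derivative F * B = C D := by
  have hinj := RingHom.injective_int (Int.castRingHom ℚ)
  obtain ⟨A, B, -, -, h⟩ := exists_mul_add_mul_eq_C_resultant F (derivative F) le_rfl le_rfl
    (by simp [hF])
  refine ⟨_, ?_, A, B, h⟩
  intro h0
  refine resultant_ne_zero _ _ hirr.separable ?_
  rw [derivative_map, natDegree_map_eq_of_injective hinj, natDegree_map_eq_of_injective hinj,
    resultant_map_map, h0, map_zero]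

theorem quinticForm_mul (F : ℤ[X]) (t x z : ℤ) :
    quinticForm F (t * x) (t * z) = t ^ 5 * quinticForm F x z := by
  simp only [quinticForm]; ring

theorem quinticForm_modEq (F : ℤ[X]) {n x z x' z' : ℤ} (hx : x ≡ x' [ZMOD n])
    (hz : z ≡ z' [ZMOD n]) : quinticForm F x z ≡ quinticForm F x' z' [ZMOD n] := by
  unfold quinticForm; gcongr

theorem exists_quinticForm_bound (F : ℤ[X]) : ∃ H : ℝ, 1 ≤ H ∧ ∀ (x z : ℤ) (T : ℝ),
    |(x : ℝ)| ≤ T → |(z : ℝ)| ≤ T → |(quinticForm F x z : ℝ)| ≤ H * T ^ 5 := by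
  refine ⟨1 + (|(F.coeff 0 : ℝ)| + |(F.coeff 1 : ℝ)| + |(F.coeff 2 : ℝ)| + |(F.coeff 3 : ℝ)| +
    |(F.coeff 4 : ℝ)| + |(F.coeff 5 : ℝ)|), le_add_of_nonneg_right (by positivity), fun x z T hx hz => ?_⟩
  have hT : 0 ≤ T := (abs_nonneg _).trans hx
  have key : ∀ (c : ℝ) (i j : ℕ), i + j = 5 → |c * (x : ℝ) ^ i * (z : ℝ) ^ j| ≤ |c| * T ^ 5 := by
    intro c i j hij
    rw [abs_mul, abs_mul, abs_pow, abs_pow, mul_assoc, ← hij, pow_add]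
    gcongr
  have e : (quinticForm F x z : ℝ) = F.coeff 0 * (x : ℝ) ^ 0 * (z : ℝ) ^ 5 +
      F.coeff 1 * (x : ℝ) ^ 1 * (z : ℝ) ^ 4 + F.coeff 2 * (x : ℝ) ^ 2 * (z : ℝ) ^ 3 +
      F.coeff 3 * (x : ℝ) ^ 3 * (z : ℝ) ^ 2 + F.coeff 4 * (x : ℝ) ^ 4 * (z : ℝ) ^ 1 +
      F.coeff 5 * (x : ℝ) ^ 5 * (z : ℝ) ^ 0 := by
    rw [quinticForm]; push_cast; ring
  rw [e]
  have k0 := key (F.coeff 0) 0 5 rfl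
  have k1 := key (F.coeff 1) 1 4 rfl
  have k2 := key (F.coeff 2) 2 3 rfl
  have k3 := key (F.coeff 3) 3 2 rfl
  have k4 := key (F.coeff 4) 4 1 rfl
  have k5 := key (F.coeff 5) 5 0 rfl
  have hT5 : 0 ≤ T ^ 5 := by positivity
  rw [abs_le] at *
  constructor <;> nlinarith

/-! ### Zeros of the form modulo primes and prime squares. -/

/-- The determinant of two integer vectors. -/
def cross (w w' : ℤ × ℤ) : ℤ := w.1 * w'.2 - w.2 * w'.1

/-- The point `x / z` of the projective line over `ZMod p` given by `(x, z)`;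
the value `none` stands for infinity. -/
def projClass (p : ℕ) (w : ℤ × ℤ) : Option (ZMod p) :=
  if (w.2 : ZMod p) = 0 then none else some ((w.1 : ZMod p) * (w.2 : ZMod p)⁻¹)

theorem dvd_cross_of_projClass_eq {p : ℕ} [Fact p.Prime] {w w' : ℤ × ℤ}
    (h : projClass p w = projClass p w') : (p : ℤ) ∣ cross w w' := by
  rw [← ZMod.intCast_zmod_eq_zero_iff_dvd _ p]
  simp only [cross, Int.cast_sub, Int.cast_mul]
  unfold projClass at h
  split_ifs at h with h1 h2 h2
  · simp [h1, h2]
  · have h3 := Option.some.inj h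
    rw [← div_eq_mul_inv, ← div_eq_mul_inv, div_eq_div_iff h1 h2] at h3
    rw [h3]; ring

/-- If p does not divide the leading coefficient, take infinity and the at most five roots of F
modulo p. Otherwise p is at most that coefficient in absolute value, and the whole projective line,
with p + 1 points, is small enough. The bound is thus uniform in p. -/
theorem exists_projClass_finset {F : ℤ[X]} (hF : F.natDegree = 5) (p : ℕ) [hp : Fact p.Prime] :
    ∃ T : Finset (Option (ZMod p)), T.card ≤ (F.coeff 5).natAbs + 6 ∧
      ∀ w : ℤ × ℤ, (p : ℤ) ∣ quinticForm F w.1 w.2 → projClass p w ∈ T := by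
  have hlead : F.coeff 5 ≠ 0 := by
    rw [← hF]; exact leadingCoeff_ne_zero.mpr (by rintro rfl; simp at hF)
  by_cases hdvd : (p : ℤ) ∣ F.coeff 5
  · refine ⟨Finset.univ, ?_, fun _ _ => Finset.mem_univ _⟩
    have := Nat.le_of_dvd (Int.natAbs_pos.mpr hlead) (Int.natCast_dvd.mp hdvd)
    simp [ZMod.card]
    omega
  · set G := F.map (Int.castRingHom (ZMod p)) with hG
    have hG0 : G ≠ 0 := by
      intro h0
      apply hdvd
      rw [← ZMod.intCast_zmod_eq_zero_iff_dvd _ p]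
      have := congrArg (fun q => q.coeff 5) h0
      simpa [hG] using this
    refine ⟨Finset.insertNone G.roots.toFinset, ?_, fun w hw => ?_⟩
    · rw [Finset.card_insertNone]
      have h1 := G.roots.toFinset_card_le
      have h2 := G.card_roots'
      have h3 : G.natDegree ≤ 5 := hF ▸ natDegree_map_le
      omega
    · unfold projClass
      split_ifs with h
      · simp
      · simp only [Finset.some_mem_insertNone, Multiset.mem_toFinset]
        rw [mem_roots hG0, IsRoot, hG, eval_map, ← div_eq_mul_inv]
        have h1 := quinticForm_cast (K := ZMod p) hF w.1 w.2 h
        rw [(ZMod.intCast_zmod_eq_zero_iff_dvd _ p).mpr hw] at h1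
        simpa [h] using h1.symm

/-- Chinese remainder theorem: as d is squarefree, the projective classes at the primes dividing d
decide proportionality modulo d. -/
theorem card_le_pow_card_primeFactors {F : ℤ[X]} (hF : F.natDegree = 5) {d : ℕ}
    (hd : Squarefree d) (W : Finset (ℤ × ℤ)) (hW : ∀ w ∈ W, (d : ℤ) ∣ quinticForm F w.1 w.2)
    (hne : ∀ w ∈ W, ∀ w' ∈ W, (d : ℤ) ∣ cross w w' → w = w') :
    W.card ≤ ((F.coeff 5).natAbs + 6) ^ d.primeFactors.card := by
  classical
  have hT : ∀ p : ℕ, ∃ T : Finset (Option (ZMod p)), T.card ≤ (F.coeff 5).natAbs + 6 ∧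
      (p.Prime → ∀ w : ℤ × ℤ, (p : ℤ) ∣ quinticForm F w.1 w.2 → projClass p w ∈ T) := by
    intro p
    by_cases hp : p.Prime
    · have := Fact.mk hp
      obtain ⟨T, h1, h2⟩ := exists_projClass_finset hF p
      exact ⟨T, h1, fun _ => h2⟩
    · exact ⟨∅, by simp, fun h => absurd h hp⟩
  choose T hT1 hT2 using hT
  calc W.card ≤ (d.primeFactors.pi T).card := by
        refine Finset.card_le_card_of_injOn (fun w p _ => projClass p w) ?_ ?_
        · intro w hw
          simp only [Finset.mem_coe, Finset.mem_pi]
          intro p hp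
          exact hT2 p (Nat.prime_of_mem_primeFactors hp) w
            ((Int.natCast_dvd_natCast.mpr (Nat.dvd_of_mem_primeFactors hp)).trans (hW w hw))
        · intro w hw w' hw' h
          refine hne w hw w' hw' ?_
          rw [← Nat.prod_primeFactors_of_squarefree hd, Int.natCast_dvd]
          refine Finset.prod_primes_dvd _
            (fun p hp => (Nat.prime_of_mem_primeFactors hp).prime) fun p hp => ?_
          have := Fact.mk (Nat.prime_of_mem_primeFactors hp)
          exact Int.natCast_dvd.mp (dvd_cross_of_projClass_eq (congrFun (congrFun h p) hp))
    _ = ∏ p ∈ d.primeFactors, (T p).card := Finset.card_pi _ _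
    _ ≤ ∏ _p ∈ d.primeFactors, ((F.coeff 5).natAbs + 6) :=
        Finset.prod_le_prod' fun p _ => hT1 p
    _ = _ := by rw [Finset.prod_const]

/-- Uniqueness in Hensel's lemma for the zeros of a quintic form modulo `p ^ 2`. -/
theorem sq_dvd_cross {F A B : ℤ[X]} {D : ℤ} (hF : F.natDegree = 5)
    (hD : F * A + derivative F * B = C D) {p : ℕ} (hp : p.Prime) (hpD : ¬ (p : ℤ) ∣ D)
    (hp5 : ¬ (p : ℤ) ∣ F.coeff 5) {w w' : ℤ × ℤ} (hw : IsCoprime w.1 w.2)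
    (hw' : IsCoprime w'.1 w'.2) (h : (p : ℤ) ^ 2 ∣ quinticForm F w.1 w.2)
    (h' : (p : ℤ) ^ 2 ∣ quinticForm F w'.1 w'.2) (hc : (p : ℤ) ∣ cross w w') :
    (p : ℤ) ^ 2 ∣ cross w w' := by
  have := Fact.mk hp
  have hpp : Prime (p : ℤ) := Nat.prime_iff_prime_int.mp hp
  have hz : ∀ v : ℤ × ℤ, IsCoprime v.1 v.2 → (p : ℤ) ^ 2 ∣ quinticForm F v.1 v.2 →
      ¬ (p : ℤ) ∣ v.2 := by
    intro v hv hpv hdvd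
    have h1 : (p : ℤ) ∣ F.coeff 5 * v.1 ^ 5 := by
      have h2 : F.coeff 5 * v.1 ^ 5 = quinticForm F v.1 v.2 - v.2 * (F.coeff 0 * v.2 ^ 4 +
          F.coeff 1 * v.1 * v.2 ^ 3 + F.coeff 2 * v.1 ^ 2 * v.2 ^ 2 + F.coeff 3 * v.1 ^ 3 * v.2 +
          F.coeff 4 * v.1 ^ 4) := by unfold quinticForm; ring
      rw [h2]
      exact dvd_sub ((dvd_pow_self _ two_ne_zero).trans hpv) (hdvd.mul_right _)
    rcases hpp.dvd_or_dvd h1 with h3 | h3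
    · exact hp5 h3
    · exact hpp.not_isUnit (hv.isUnit_of_dvd' (hpp.dvd_of_dvd_pow h3) hdvd)
  have hz1 := hz w hw h
  have hz2 := hz w' hw' h'
  obtain ⟨x, z⟩ := w
  obtain ⟨x', z'⟩ := w'
  simp only [cross] at *
  set a0 := F.coeff 0
  set a1 := F.coeff 1
  set a2 := F.coeff 2
  set a3 := F.coeff 3
  set a4 := F.coeff 4
  set a5 := F.coeff 5
  set s := z * z' with hs
  set Y := x' * z with hY
  set δ := x * z' - z * x' with hδ
  -- Over the common second coordinate s the two points become (Y + δ, s) and (Y, s). `fx` is the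
  -- x-derivative of the form at (Y, s), and `e1` is the Taylor expansion in δ.
  set fx := a1 * s ^ 4 + 2 * a2 * Y * s ^ 3 + 3 * a3 * Y ^ 2 * s ^ 2 + 4 * a4 * Y ^ 3 * s +
    5 * a5 * Y ^ 4 with hfx
  have hX : x * z' = Y + δ := by rw [hδ, hY]; ring
  have e1 : z' ^ 5 * quinticForm F x z - z ^ 5 * quinticForm F x' z' = δ * fx +
      δ ^ 2 * (a2 * s ^ 3 + a3 * (3 * Y + δ) * s ^ 2 + a4 * (6 * Y ^ 2 + 4 * Y * δ + δ ^ 2) * s +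
        a5 * (10 * Y ^ 3 + 10 * Y ^ 2 * δ + 5 * Y * δ ^ 2 + δ ^ 3)) := by
    rw [← quinticForm_mul, ← quinticForm_mul, mul_comm z' x, hX, mul_comm z x', ← hY,
      mul_comm z' z, ← hs]
    simp only [quinticForm, hfx, a1, a2, a3, a4, a5]
    ring
  have e2 : (p : ℤ) ^ 2 ∣ δ * fx := by
    have h1 := dvd_sub (h.mul_left (z' ^ 5)) (h'.mul_left (z ^ 5))
    rw [e1] at h1
    exact (dvd_add_left ((pow_dvd_pow_of_dvd hc 2).mul_right _)).mp h1
  -- Otherwise x' / z' would be a double root of F modulo p, and the Bézout relation would force p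
  -- to divide D.
  have e3 : ¬ (p : ℤ) ∣ fx := by
    intro hdvd
    have hzp : (z : ZMod p) ≠ 0 := by
      rwa [Ne, ZMod.intCast_zmod_eq_zero_iff_dvd _ p]
    have hzp' : (z' : ZMod p) ≠ 0 := by
      rwa [Ne, ZMod.intCast_zmod_eq_zero_iff_dvd _ p]
    set r : ZMod p := x' / z' with hr
    have f1 : F.eval₂ (Int.castRingHom (ZMod p)) r = 0 := by
      have h1 := quinticForm_cast (K := ZMod p) hF x' z' hzp'
      rw [(ZMod.intCast_zmod_eq_zero_iff_dvd _ p).mpr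
        ((dvd_pow_self _ two_ne_zero).trans h')] at h1
      simpa [hzp'] using h1.symm
    have f2 : (derivative F).eval₂ (Int.castRingHom (ZMod p)) r = 0 := by
      have h1 := (ZMod.intCast_zmod_eq_zero_iff_dvd _ p).mpr hdvd
      have h2 : (x' : ZMod p) = r * z' := by rw [hr]; field_simp
      have h3 : ((fx : ℤ) : ZMod p) =
          ((z : ZMod p) * z') ^ 4 * (derivative F).eval₂ (Int.castRingHom (ZMod p)) r := by
        have hd : (derivative F).natDegree < 5 := by
          have := natDegree_derivative_lt (p := F) (by omega)
          omega
        rw [eval₂_eq_sum_range' _ hd, hfx, hY, hs]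
        push_cast
        rw [h2]
        simp only [Finset.sum_range_succ, Finset.sum_range_zero, coeff_derivative, eq_intCast,
          a1, a2, a3, a4, a5]
        push_cast
        ring
      rw [h1] at h3
      simpa [hzp, hzp'] using h3.symm
    apply hpD
    rw [← ZMod.intCast_zmod_eq_zero_iff_dvd _ p]
    have h1 := congrArg (eval₂ (Int.castRingHom (ZMod p)) r) hD
    rw [eval₂_C, eval₂_add, eval₂_mul, eval₂_mul, f1, f2, zero_mul, zero_mul, add_zero] at h1
    exact h1.symm
  have e4 : IsCoprime ((p : ℤ) ^ 2) fx :=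
    (((Prime.coprime_iff_not_dvd hpp).mpr e3)).pow_left
  exact e4.dvd_of_dvd_mul_right e2

/-! ### Boundedly many points for each prime. -/

theorem eq_or_eq_neg_of_cross_eq_zero {w w' : ℤ × ℤ} (hw : IsCoprime w.1 w.2)
    (hw' : IsCoprime w'.1 w'.2) (h : cross w w' = 0) : w' = w ∨ w' = -w := by
  obtain ⟨x, z⟩ := w
  obtain ⟨x', z'⟩ := w'
  simp only [cross] at *
  have h1 : x ∣ x' := hw.dvd_of_dvd_mul_left ⟨z', by linarith⟩
  have h2 : x' ∣ x := hw'.dvd_of_dvd_mul_right ⟨z, by linarith⟩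
  have h3 : z ∣ z' := hw.symm.dvd_of_dvd_mul_right ⟨x', by linarith⟩
  have h4 : z' ∣ z := hw'.symm.dvd_of_dvd_mul_left ⟨x, by linarith⟩
  simp only [Prod.neg_mk, Prod.mk.injEq]
  rcases Int.associated_iff.mp (associated_of_dvd_dvd h1 h2) with rfl | rfl <;>
    rcases Int.associated_iff.mp (associated_of_dvd_dvd h3 h4) with rfl | rfl
  · simp
  · rcases mul_eq_zero.mp (show x * z' = 0 by linarith) with rfl | rfl <;> simp
  · rcases mul_eq_zero.mp (show x' * z = 0 by linarith) with rfl | rfl <;> simp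
  · simp

/-- Determinants against two independent vectors serve as coordinates (Cramer's rule). -/
theorem eq_of_cross_eq {w₁ w₂ v v' : ℤ × ℤ} (h : cross w₁ w₂ ≠ 0)
    (h1 : cross v w₁ = cross v' w₁) (h2 : cross v w₂ = cross v' w₂) : v = v' := by
  obtain ⟨x, z⟩ := v
  obtain ⟨x', z'⟩ := v'
  simp only [cross] at *
  have e1 : (x - x') * (w₁.1 * w₂.2 - w₁.2 * w₂.1) = 0 := by
    linear_combination w₁.1 * h2 - w₂.1 * h1
  have e2 : (z - z') * (w₁.1 * w₂.2 - w₁.2 * w₂.1) = 0 := by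
    linear_combination w₁.2 * h2 - w₂.2 * h1
  have e3 := (mul_eq_zero.mp e1).resolve_right h
  have e4 := (mul_eq_zero.mp e2).resolve_right h
  ext <;> simp <;> linarith

/-- Every determinant is a multiple of m of size at most 2N² < 2m, hence 0 or ±m. Either all points
are proportional, leaving at most a pair ±w, or determinants against two independent points separate
S into 3 · 3 possibilities. It is applied with m = p². -/
theorem card_le_nine {m N : ℤ} (hNm : 2 * N ^ 2 < 2 * m) (S : Finset (ℤ × ℤ))
    (hcop : ∀ w ∈ S, IsCoprime w.1 w.2) (hbd : ∀ w ∈ S, |w.1| ≤ N ∧ |w.2| ≤ N)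
    (hdvd : ∀ w ∈ S, ∀ w' ∈ S, m ∣ cross w w') : S.card ≤ 9 := by
  have key : ∀ w ∈ S, ∀ w' ∈ S, cross w w' ∈ ({0, m, -m} : Finset ℤ) := by
    intro w hw w' hw'
    obtain ⟨k, hk⟩ := hdvd w hw w' hw'
    have hb : |cross w w'| ≤ 2 * N ^ 2 := by
      have h1 : |w.1 * w'.2| ≤ N * N := by
        rw [abs_mul]; exact mul_le_mul (hbd w hw).1 (hbd w' hw').2 (abs_nonneg _)
          ((abs_nonneg _).trans (hbd w hw).1)
      have h2 : |w.2 * w'.1| ≤ N * N := by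
        rw [abs_mul]; exact mul_le_mul (hbd w hw).2 (hbd w' hw').1 (abs_nonneg _)
          ((abs_nonneg _).trans (hbd w hw).1)
      calc |cross w w'| ≤ |w.1 * w'.2| + |w.2 * w'.1| := abs_sub _ _
        _ ≤ 2 * N ^ 2 := by linarith
    have hm : 0 < m := by nlinarith [sq_nonneg N]
    have hk2 : |k| < 2 := by
      rw [hk, abs_mul, abs_of_pos hm] at hb
      nlinarith
    rw [abs_lt] at hk2
    have : k = 0 ∨ k = 1 ∨ k = -1 := by omega
    rw [hk]
    rcases this with rfl | rfl | rfl <;> simp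
  by_cases hall : ∀ w ∈ S, ∀ w' ∈ S, cross w w' = 0
  · rcases S.eq_empty_or_nonempty with rfl | ⟨w, hw⟩
    · simp
    · have : S ⊆ {w, -w} := fun w' hw' => by
        simpa using eq_or_eq_neg_of_cross_eq_zero (hcop w hw) (hcop w' hw') (hall w hw w' hw')
      exact (Finset.card_le_card this).trans (Finset.card_le_two.trans (by norm_num))
  · push Not at hall
    obtain ⟨w₁, hw₁, w₂, hw₂, hne⟩ := hall
    have h1 : S.card ≤ (({0, m, -m} : Finset ℤ) ×ˢ ({0, m, -m} : Finset ℤ)).card := by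
      refine Finset.card_le_card_of_injOn (fun v => (cross v w₁, cross v w₂)) ?_ ?_
      · intro v hv
        exact Finset.mem_coe.mpr
          (Finset.mem_product.mpr ⟨key v (by simpa using hv) w₁ hw₁, key v (by simpa using hv) w₂ hw₂⟩)
      · intro v _ v' _ h
        exact eq_of_cross_eq hne (Prod.ext_iff.mp h).1 (Prod.ext_iff.mp h).2
    have h2 : ({0, m, -m} : Finset ℤ).card ≤ 3 := Finset.card_le_three
    rw [Finset.card_product] at h1
    nlinarith

/-- Only boundedly many coprime points of the box `|x|, |z| ≤ N` have a value divisible by the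
square of a given prime `p > N`. -/
theorem card_sq_dvd_le {F A B : ℤ[X]} {D : ℤ} (hF : F.natDegree = 5)
    (hD : F * A + derivative F * B = C D) {p : ℕ} (hp : p.Prime) (hpD : ¬ (p : ℤ) ∣ D)
    (hp5 : ¬ (p : ℤ) ∣ F.coeff 5) {N : ℕ} (hNp : N < p) (S : Finset (ℤ × ℤ))
    (hcop : ∀ w ∈ S, IsCoprime w.1 w.2) (hbd : ∀ w ∈ S, |w.1| ≤ N ∧ |w.2| ≤ N)
    (hdvd : ∀ w ∈ S, (p : ℤ) ^ 2 ∣ quinticForm F w.1 w.2) :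
    S.card ≤ 9 * ((F.coeff 5).natAbs + 6) := by
  have := Fact.mk hp
  obtain ⟨T, hT1, hT2⟩ := exists_projClass_finset hF p
  refine (Finset.card_le_mul_card_image_of_maps_to (f := projClass p) (t := T)
    (fun w hw => hT2 w ((dvd_pow_self _ two_ne_zero).trans (hdvd w hw))) 9 ?_).trans
    (Nat.mul_le_mul_left _ hT1)
  intro t _
  have hmem : ∀ w ∈ S.filter (fun w => projClass p w = t), w ∈ S :=
    fun w hw => (Finset.mem_filter.mp hw).1
  refine card_le_nine (m := (p : ℤ) ^ 2) (N := N) ?_ _ (fun w hw => hcop w (hmem w hw))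
    (fun w hw => hbd w (hmem w hw)) fun w hw w' hw' => ?_
  · have : (N : ℤ) < p := by exact_mod_cast hNp
    nlinarith
  · exact sq_dvd_cross hF hD hp hpD hp5 (hcop w (hmem w hw)) (hcop w' (hmem w' hw'))
      (hdvd w (hmem w hw)) (hdvd w' (hmem w' hw')) (dvd_cross_of_projClass_eq
        ((Finset.mem_filter.mp hw).2.trans (Finset.mem_filter.mp hw').2.symm))

/-! ### Lattices of vectors proportional to a given one modulo d. -/

/-- The square of the Euclidean length of an integer vector. -/
def sqNorm (w : ℤ × ℤ) : ℤ := w.1 ^ 2 + w.2 ^ 2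

theorem sqNorm_nonneg (w : ℤ × ℤ) : 0 ≤ sqNorm w := by unfold sqNorm; positivity

theorem cross_sq_le (w w' : ℤ × ℤ) : cross w w' ^ 2 ≤ sqNorm w * sqNorm w' := by
  unfold cross sqNorm; nlinarith [sq_nonneg (w.1 * w'.1 + w.2 * w'.2)]

theorem cross_add_left (a b c : ℤ × ℤ) : cross (a + b) c = cross a c + cross b c := by
  simp only [cross, Prod.fst_add, Prod.snd_add]; ring

theorem cross_sub_left (a b c : ℤ × ℤ) : cross (a - b) c = cross a c - cross b c := by
  simp only [cross, Prod.fst_sub, Prod.snd_sub]; ring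

/-- A Gauss-reduced basis of the lattice of vectors parallel to `w₀` modulo `d`. -/
theorem exists_reduced_basis {w₀ : ℤ × ℤ} (hw₀ : IsCoprime w₀.1 w₀.2) {d : ℤ} :
    ∃ b₁ b₂ : ℤ × ℤ, d ∣ cross b₁ w₀ ∧ d ∣ cross b₂ w₀ ∧ cross b₁ b₂ = d ∧
      sqNorm b₁ ≤ sqNorm b₂ ∧ 3 * (sqNorm b₁ * sqNorm b₂) ≤ 4 * d ^ 2 := by
  let S : Set ((ℤ × ℤ) × (ℤ × ℤ)) :=
    {b | d ∣ cross b.1 w₀ ∧ d ∣ cross b.2 w₀ ∧ cross b.1 b.2 = d}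
  have hne : S.Nonempty := by
    obtain ⟨α, β, h⟩ := hw₀
    refine ⟨(w₀, (-(d * β), d * α)), ?_, ⟨-1, ?_⟩, ?_⟩
    · simp only [cross]; exact ⟨0, by ring⟩
    · simp only [cross]; linear_combination -d * h
    · simp only [cross]; linear_combination d * h
  -- Among lattice pairs of determinant d, take one minimising the sum of squared lengths.
  -- Comparison with the four elementary moves `i1` to `i4` gives |2 b₁·b₂| ≤ min(|b₁|², |b₂|²).
  -- With |b₁|²|b₂|² = d² + (b₁·b₂)² this is the claimed bound.
  obtain ⟨⟨b₁, b₂⟩, ⟨h1, h2, h3⟩, hmin⟩ := (measure fun b : (ℤ × ℤ) × (ℤ × ℤ) =>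
    (sqNorm b.1 + sqNorm b.2).toNat).wf.has_min S hne
  have hmin' : ∀ c₁ c₂ : ℤ × ℤ, d ∣ cross c₁ w₀ → d ∣ cross c₂ w₀ → cross c₁ c₂ = d →
      sqNorm b₁ + sqNorm b₂ ≤ sqNorm c₁ + sqNorm c₂ := by
    intro c₁ c₂ k1 k2 k3
    have := hmin (c₁, c₂) ⟨k1, k2, k3⟩
    have n1 := sqNorm_nonneg c₁
    have n2 := sqNorm_nonneg c₂
    have : ¬ (sqNorm c₁ + sqNorm c₂).toNat < (sqNorm b₁ + sqNorm b₂).toNat := this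
    omega
  simp only at h1 h2 h3
  have i1 := hmin' b₁ (b₂ + b₁) h1
    (by rw [cross_add_left]; exact dvd_add h2 h1)
    (by simp only [cross, Prod.fst_add, Prod.snd_add] at *; linarith)
  have i2 := hmin' b₁ (b₂ - b₁) h1
    (by rw [cross_sub_left]; exact dvd_sub h2 h1)
    (by simp only [cross, Prod.fst_sub, Prod.snd_sub] at *; linarith)
  have i3 := hmin' (b₁ + b₂) b₂
    (by rw [cross_add_left]; exact dvd_add h1 h2)
    h2 (by simp only [cross, Prod.fst_add, Prod.snd_add] at *; linarith)
  have i4 := hmin' (b₁ - b₂) b₂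
    (by rw [cross_sub_left]; exact dvd_sub h1 h2)
    h2 (by simp only [cross, Prod.fst_sub, Prod.snd_sub] at *; linarith)
  have key : 3 * (sqNorm b₁ * sqNorm b₂) ≤ 4 * d ^ 2 := by
    set s := b₁.1 * b₂.1 + b₁.2 * b₂.2 with hs
    have e : sqNorm b₁ * sqNorm b₂ = d ^ 2 + s ^ 2 := by
      rw [← h3, hs]; simp only [sqNorm, cross]; ring
    have j1 : |2 * s| ≤ sqNorm b₁ := by
      simp only [sqNorm, Prod.fst_add, Prod.snd_add, Prod.fst_sub, Prod.snd_sub] at *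
      rw [abs_le]; constructor <;> linarith
    have j2 : |2 * s| ≤ sqNorm b₂ := by
      simp only [sqNorm, Prod.fst_add, Prod.snd_add, Prod.fst_sub, Prod.snd_sub] at *
      rw [abs_le]; constructor <;> linarith
    have j3 : |2 * s| * |2 * s| ≤ sqNorm b₁ * sqNorm b₂ :=
      mul_le_mul j1 j2 (abs_nonneg _) (sqNorm_nonneg _)
    rw [abs_mul_abs_self] at j3
    linarith
  rcases le_total (sqNorm b₁) (sqNorm b₂) with h | h
  · exact ⟨b₁, b₂, h1, h2, h3, h, key⟩
  -- The sign keeps the determinant equal to d after the swap.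
  · refine ⟨b₂, -b₁, h2, ?_, ?_, ?_, ?_⟩
    · simpa [cross, neg_add_eq_sub] using (dvd_neg.mpr h1)
    · rw [← h3]; simp only [cross, Prod.fst_neg, Prod.snd_neg]; ring
    · simpa [sqNorm] using h
    · have : sqNorm (-b₁) = sqNorm b₁ := by simp [sqNorm]
      rw [this]; linarith

/-- Modulo d both vectors are multiples of the primitive vector w₀, with multipliers read off from a
Bézout relation for w₀. -/
theorem dvd_cross_of_dvd_cross {w₀ w w' : ℤ × ℤ} (hw₀ : IsCoprime w₀.1 w₀.2) {d : ℤ}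
    (h : d ∣ cross w w₀) (h' : d ∣ cross w' w₀) : d ∣ cross w w' := by
  obtain ⟨α, β, hab⟩ := hw₀
  have e : cross w w' = (α * w'.1 + β * w'.2) * cross w w₀ -
      (α * w.1 + β * w.2) * cross w' w₀ := by
    simp only [cross]; linear_combination (w.2 * w'.1 - w.1 * w'.2) * hab
  rw [e]
  exact dvd_sub (h.mul_left _) (h'.mul_left _)

/-- Cramer's rule: the numerators are determinants of vectors parallel modulo d, so division by the
determinant d is exact. -/
theorem exists_coordinates {w₀ b₁ b₂ w : ℤ × ℤ} (hw₀ : IsCoprime w₀.1 w₀.2) {d : ℤ}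
    (hd : d ≠ 0) (h1 : d ∣ cross b₁ w₀) (h2 : d ∣ cross b₂ w₀) (hb : cross b₁ b₂ = d)
    (hw : d ∣ cross w w₀) :
    ∃ u v : ℤ, w = (u * b₁.1 + v * b₂.1, u * b₁.2 + v * b₂.2) ∧
      cross w b₂ = d * u ∧ cross b₁ w = d * v := by
  obtain ⟨u, hu⟩ := dvd_cross_of_dvd_cross hw₀ hw h2
  obtain ⟨v, hv⟩ := dvd_cross_of_dvd_cross hw₀ h1 hw
  refine ⟨u, v, ?_, hu, hv⟩
  simp only [cross] at *
  ext
  · apply mul_left_cancel₀ hd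
    linear_combination (-w.1) * hb + b₁.1 * hu + b₂.1 * hv
  · apply mul_left_cancel₀ hd
    linear_combination (-w.2) * hb + b₁.2 * hu + b₂.2 * hv

/-- Modulo d, b is t times w₀, and homogeneity gives the value t^5 times the value at w₀. -/
theorem dvd_quinticForm_of_dvd_cross (F : ℤ[X]) {w₀ b : ℤ × ℤ} (hw₀ : IsCoprime w₀.1 w₀.2) {d : ℤ}
    (h : d ∣ quinticForm F w₀.1 w₀.2) (hb : d ∣ cross b w₀) : d ∣ quinticForm F b.1 b.2 := by
  obtain ⟨α, β, hab⟩ := hw₀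
  set t := α * b.1 + β * b.2 with ht
  obtain ⟨k, hk⟩ := hb
  simp only [cross] at hk
  have e1 : b.1 ≡ t * w₀.1 [ZMOD d] := by
    rw [Int.modEq_iff_dvd]
    exact ⟨-(β * k), by rw [ht]; linear_combination b.1 * hab - β * hk⟩
  have e2 : b.2 ≡ t * w₀.2 [ZMOD d] := by
    rw [Int.modEq_iff_dvd]
    exact ⟨α * k, by rw [ht]; linear_combination b.2 * hab + α * hk⟩
  have e3 := quinticForm_modEq F e1 e2
  rw [quinticForm_mul] at e3
  exact (Int.ModEq.dvd_iff e3).mpr (h.mul_left _)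

/-! ### Periodic sums, character sums and the square sieve. -/

theorem sum_range_eq_of_periodic {h : ℤ → ℤ} {M : ℕ} (hper : ∀ n, h (n + M) = h n) (m : ℤ) :
    ∑ i ∈ Finset.range M, h (m + i) = ∑ i ∈ Finset.range M, h i := by
  have step : ∀ m : ℤ, ∑ i ∈ Finset.range M, h (m + 1 + i) = ∑ i ∈ Finset.range M, h (m + i) := by
    intro m
    have h1 := Finset.sum_range_succ (fun i : ℕ => h (m + i)) M
    have h2 := Finset.sum_range_succ' (fun i : ℕ => h (m + i)) M
    simp only [Nat.cast_add, Nat.cast_one, Nat.cast_zero, add_zero] at h1 h2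
    rw [h1, hper] at h2
    have h3 : ∑ i ∈ Finset.range M, h (m + 1 + i) = ∑ i ∈ Finset.range M, h (m + (i + 1)) :=
      Finset.sum_congr rfl fun i _ => by congr 1; ring
    linarith
  induction m using Int.induction_on with
  | zero => simp
  | succ k ih => rw [step, ih]
  | pred k ih => rw [← ih, ← step]; simp

/-- Each full period costs at most s and the incomplete one at most M c; multiplying by M avoids
division. -/
theorem abs_sum_periodic_le {h : ℤ → ℤ} {M : ℕ} {c s : ℤ} (hper : ∀ n, h (n + M) = h n)
    (hc : ∀ n, |h n| ≤ c) (hs : |∑ i ∈ Finset.range M, h i| ≤ s) (m : ℤ) (n : ℕ) :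
    M * |∑ i ∈ Finset.range n, h (m + i)| ≤ n * s + M * M * c := by
  have hc0 : 0 ≤ c := (abs_nonneg _).trans (hc 0)
  have hs0 : 0 ≤ s := (abs_nonneg _).trans hs
  induction n using Nat.strong_induction_on with
  | _ n ih =>
    rcases Nat.eq_zero_or_pos M with rfl | hM
    · simp only [Nat.cast_zero, zero_mul, add_zero]; positivity
    rcases lt_or_ge n M with hn | hn
    · have h1 : |∑ i ∈ Finset.range n, h (m + i)| ≤ M * c := by
        refine (Finset.abs_sum_le_sum_abs _ _).trans ((Finset.sum_le_card_nsmul _ _ c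
          fun i _ => hc _).trans ?_)
        rw [Finset.card_range, nsmul_eq_mul]
        gcongr
      have h2 := mul_le_mul_of_nonneg_left h1 (Int.natCast_nonneg M)
      have : 0 ≤ (n : ℤ) * s := by positivity
      linarith
    · obtain ⟨k, rfl⟩ := Nat.exists_eq_add_of_le' hn
      rw [Finset.sum_range_add]
      have h1 : ∑ x ∈ Finset.range M, h (m + ((k + x : ℕ) : ℤ)) = ∑ i ∈ Finset.range M, h i := by
        rw [← sum_range_eq_of_periodic hper (m + k)]
        exact Finset.sum_congr rfl fun i _ => by push_cast; congr 1; ring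
      rw [h1]
      have h2 := ih k (by omega)
      have h3 := abs_add_le (∑ i ∈ Finset.range k, h (m + i)) (∑ i ∈ Finset.range M, h i)
      have h4 := mul_le_mul_of_nonneg_left (h3.trans (add_le_add_right hs _))
        (Int.natCast_nonneg M)
      push_cast
      linarith

/-- Sums over a rectangle of a doubly periodic function with mean zero are small. -/
theorem abs_sum_sum_periodic_le {f : ℤ → ℤ → ℤ} {M : ℕ} (hM : 0 < M)
    (hper₁ : ∀ u v, f (u + M) v = f u v) (hper₂ : ∀ u v, f u (v + M) = f u v)
    (hf : ∀ u v, |f u v| ≤ 1)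
    (hzero : ∑ i ∈ Finset.range M, ∑ j ∈ Finset.range M, f i j = 0) (m k : ℤ) (a b : ℕ) :
    |∑ i ∈ Finset.range a, ∑ j ∈ Finset.range b, f (m + i) (k + j)| ≤ M * (a + b) := by
  have hM' : (0 : ℤ) < M := by exact_mod_cast hM
  -- The one-dimensional bound is used twice: first on sums over a full period in u, whose own
  -- period sum is 0, then on rows of length b, whose period sum is at most M² by the first use.
  have h1 : |∑ j ∈ Finset.range b, ∑ i ∈ Finset.range M, f i (k + j)| ≤ M * M := by
    have := abs_sum_periodic_le (h := fun v => ∑ i ∈ Finset.range M, f i v) (M := M) (c := M)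
      (s := 0) (fun n => by simp only [hper₂]) (fun n => by
        refine (Finset.abs_sum_le_sum_abs _ _).trans ((Finset.sum_le_card_nsmul _ _ 1
          fun i _ => hf _ _).trans ?_)
        simp) (by rw [Finset.sum_comm] at hzero; simp [hzero]) k b
    simp only [mul_zero, zero_add, mul_assoc] at this
    exact le_of_mul_le_mul_left this hM'
  have h2 := abs_sum_periodic_le (h := fun u => ∑ j ∈ Finset.range b, f u (k + j)) (M := M)
    (c := b) (s := M * M) (fun n => by simp only [hper₁]) (fun n => by
        refine (Finset.abs_sum_le_sum_abs _ _).trans ((Finset.sum_le_card_nsmul _ _ 1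
          fun i _ => hf _ _).trans ?_)
        simp) (by rw [Finset.sum_comm]; exact h1) m a
  have h3 : (M : ℤ) * |∑ i ∈ Finset.range a, ∑ j ∈ Finset.range b, f (m + i) (k + j)| ≤
      M * (M * (a + b)) := by linarith
  exact le_of_mul_le_mul_left h3 hM'

/-- Chinese remainder theorem: take a nonsquare modulo p that is 1 modulo q. -/
theorem exists_jacobiSym_mul_eq_neg_one {p q : ℕ} (hp : p.Prime) (hq : q.Prime) (hp2 : 2 < p)
    (hpq : p ≠ q) : ∃ t : ℤ, jacobiSym t (p * q) = -1 := by
  have := Fact.mk hp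
  have := Fact.mk hq
  obtain ⟨a, ha⟩ := FiniteField.exists_nonsquare (F := ZMod p)
    (by rw [ZMod.ringChar_zmod_n]; omega)
  have h1 : jacobiSym (a.val : ℤ) p = -1 := by
    rw [ZMod.nonsquare_iff_jacobiSym_eq_neg_one]
    simpa using ha
  obtain ⟨t, ht1, ht2⟩ := Nat.chineseRemainder ((Nat.coprime_primes hp hq).mpr hpq) a.val 1
  refine ⟨t, ?_⟩
  rw [jacobiSym.mul_right, jacobiSym.mod_left' (a₂ := (a.val : ℤ)) (by exact_mod_cast ht1), h1,
    jacobiSym.mod_left' (a₁ := (t : ℤ)) (a₂ := 1) (by exact_mod_cast ht2), jacobiSym.one_left]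
  rfl

/-- Complete character sums of a form of odd degree vanish. -/
theorem sum_sum_jacobiSym_eq_zero {g : ℤ → ℤ → ℤ}
    (hhom : ∀ t u v, g (t * u) (t * v) = t ^ 5 * g u v)
    (hmod : ∀ n u v u' v' : ℤ, u ≡ u' [ZMOD n] → v ≡ v' [ZMOD n] → g u v ≡ g u' v' [ZMOD n])
    {M : ℕ} (hM : 0 < M) {t : ℤ} (ht : jacobiSym t M = -1) :
    ∑ i ∈ Finset.range M, ∑ j ∈ Finset.range M, jacobiSym (g i j) M = 0 := by
  have : NeZero M := ⟨hM.ne'⟩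
  set G : ZMod M → ZMod M → ℤ := fun a b => jacobiSym (g a.val b.val) M with hG
  have hGmod : ∀ u v : ℤ, G u v = jacobiSym (g u v) M := by
    intro u v
    refine jacobiSym.mod_left' (hmod M _ _ _ _ ?_ ?_) <;>
    · rw [← ZMod.intCast_eq_intCast_iff]; simp
  have htu : IsUnit (t : ZMod M) := by
    have h1 : t.gcd M = 1 := by
      by_contra h
      rw [jacobiSym.eq_zero_iff_not_coprime.mpr h] at ht
      norm_num at ht
    exact (ZMod.coe_int_isUnit_iff_isCoprime t M).mpr (Int.isCoprime_iff_gcd_eq_one.mpr h1).symm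
  -- Scaling by t multiplies the symbol by (-1)^5 = -1 while permuting the pairs of residues, so the
  -- complete sum equals its own negative.
  have hscale : ∀ a b : ZMod M, G (t * a) (t * b) = -G a b := by
    intro a b
    have h1 := hGmod (t * a.val) (t * b.val)
    push_cast at h1
    simp only [ZMod.natCast_val, ZMod.cast_id', id_eq] at h1
    rw [h1, hG]
    simp only [← ZMod.natCast_val]
    rw [hhom, jacobiSym.mul_left, jacobiSym.pow_left, ht]
    norm_num
  have hsum : ∑ a : ZMod M, ∑ b : ZMod M, G a b = 0 := by
    have h1 : ∑ a : ZMod M, ∑ b : ZMod M, G a b =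
        ∑ a : ZMod M, ∑ b : ZMod M, G (t * a) (t * b) := by
      obtain ⟨τ, hτ⟩ := htu
      rw [← hτ]
      rw [← Equiv.sum_comp (Units.mulLeft τ)]
      refine Finset.sum_congr rfl fun a _ => ?_
      rw [← Equiv.sum_comp (Units.mulLeft τ)]
      rfl
    simp only [hscale, Finset.sum_neg_distrib] at h1
    linarith
  have hrange : ∀ h : ZMod M → ℤ, ∑ a : ZMod M, h a = ∑ i ∈ Finset.range M, h (i : ZMod M) := by
    intro h
    refine (Finset.sum_bij' (fun (i : ℕ) _ => (i : ZMod M)) (fun a _ => a.val) ?_ ?_ ?_ ?_ ?_).symm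
    · simp
    · intro a _; simpa using a.val_lt
    · intro i hi; exact ZMod.val_natCast_of_lt (by simpa using hi)
    · simp
    · simp
  rw [hrange] at hsum
  simp only [hrange] at hsum
  rw [← hsum]
  refine Finset.sum_congr rfl fun i _ => Finset.sum_congr rfl fun j _ => ?_
  rw [← hGmod]; simp

theorem sum_sum_comm {ι κ : Type*} (s t : Finset ι) (P Q : Finset κ) (f : ι → ι → κ → κ → ℤ) :
    ∑ i ∈ s, ∑ j ∈ t, ∑ p ∈ P, ∑ q ∈ Q, f i j p q =
      ∑ p ∈ P, ∑ q ∈ Q, ∑ i ∈ s, ∑ j ∈ t, f i j p q := by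
  rw [Finset.sum_congr rfl fun i _ => Finset.sum_comm, Finset.sum_comm]
  refine Finset.sum_congr rfl fun p _ => ?_
  rw [Finset.sum_congr rfl fun i _ => Finset.sum_comm, Finset.sum_comm]

theorem abs_jacobiSym_le_one (a : ℤ) (n : ℕ) : |jacobiSym a n| ≤ 1 := by
  rcases jacobiSym.trichotomy a n with h | h | h <;> simp [h]

/-- The square sieve for a binary form of odd degree. -/
theorem square_sieve {g : ℤ → ℤ → ℤ}
    (hhom : ∀ t u v, g (t * u) (t * v) = t ^ 5 * g u v)
    (hmod : ∀ n u v u' v' : ℤ, u ≡ u' [ZMOD n] → v ≡ v' [ZMOD n] → g u v ≡ g u' v' [ZMOD n])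
    {P : Finset ℕ} {Q : ℕ} (hP : ∀ p ∈ P, p.Prime ∧ 2 < p ∧ p ≤ Q) {A B : ℕ}
    {S : Finset (ℤ × ℤ)} (hS : ∀ s ∈ S, |s.1| ≤ A ∧ |s.2| ≤ B)
    (hsq : ∀ s ∈ S, (P.card : ℤ) ≤ 2 * ∑ p ∈ P, jacobiSym (g s.1 s.2) p) :
    (S.card : ℤ) * P.card ^ 2 ≤ 4 * (P.card * ((2 * A + 1) * (2 * B + 1)) +
      P.card ^ 2 * (Q ^ 2 * ((2 * A + 1) + (2 * B + 1)))) := by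
  classical
  set a := 2 * A + 1 with ha
  set b := 2 * B + 1 with hb
  -- On S, 4 X² is at least |P|². By positivity the sum of 4 X² may be extended to the whole box,
  -- where the square is expanded over pairs of primes.
  set X : ℤ → ℤ → ℤ := fun u v => ∑ p ∈ P, jacobiSym (g u v) p with hX
  have h1 : (S.card : ℤ) * P.card ^ 2 ≤ ∑ s ∈ S, 4 * X s.1 s.2 ^ 2 := by
    rw [← nsmul_eq_mul]
    refine Finset.card_nsmul_le_sum _ _ _ fun s hs => ?_
    have h2 := pow_le_pow_left₀ (Int.natCast_nonneg P.card) (hsq s hs) 2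
    have e : (2 * ∑ p ∈ P, jacobiSym (g s.1 s.2) p) ^ 2 = 4 * X s.1 s.2 ^ 2 := by rw [hX]; ring
    rwa [e] at h2
  have h2 : ∑ s ∈ S, 4 * X s.1 s.2 ^ 2 ≤ ∑ i ∈ Finset.range a, ∑ j ∈ Finset.range b,
      4 * X (-A + i) (-B + j) ^ 2 := by
    rw [← Finset.sum_product']
    rw [← Finset.sum_image (f := fun s : ℤ × ℤ => 4 * X s.1 s.2 ^ 2)
      (g := fun q : ℕ × ℕ => ((-A + q.1 : ℤ), (-B + q.2 : ℤ)))
      (fun q _ q' _ h => by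
        simp only [Prod.mk.injEq, add_right_inj, Nat.cast_inj] at h
        exact Prod.ext h.1 h.2)]
    refine Finset.sum_le_sum_of_subset_of_nonneg (fun s hs => ?_) fun _ _ _ => by positivity
    obtain ⟨k1, k2⟩ := hS s hs
    rw [abs_le] at k1 k2
    rw [Finset.mem_image]
    refine ⟨((s.1 + A).toNat, (s.2 + B).toNat), ?_, ?_⟩
    · simp only [Finset.mem_product, Finset.mem_range]; omega
    · ext <;> simp <;> omega
  have h3 : ∑ i ∈ Finset.range a, ∑ j ∈ Finset.range b, 4 * X (-A + i) (-B + j) ^ 2 =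
      4 * ∑ p ∈ P, ∑ q ∈ P, ∑ i ∈ Finset.range a, ∑ j ∈ Finset.range b,
        jacobiSym (g (-A + i) (-B + j)) p * jacobiSym (g (-A + i) (-B + j)) q := by
    simp only [hX, sq, Finset.sum_mul_sum, ← Finset.mul_sum (a := (4 : ℤ))]
    rw [sum_sum_comm]
  -- Diagonal pairs are bounded by the area of the box. Off the diagonal the symbol has modulus pq ≤
  -- Q² and mean zero, so only the perimeter counts.
  have h4 : ∀ p ∈ P, ∀ q ∈ P, ∑ i ∈ Finset.range a, ∑ j ∈ Finset.range b,
      jacobiSym (g (-A + i) (-B + j)) p * jacobiSym (g (-A + i) (-B + j)) q ≤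
      (if p = q then (a * b : ℤ) else 0) + Q ^ 2 * (a + b) := by
    intro p hp q hq
    obtain ⟨pp, p2, pQ⟩ := hP p hp
    obtain ⟨qp, q2, qQ⟩ := hP q hq
    have hnn : (0 : ℤ) ≤ Q ^ 2 * (a + b) := by positivity
    split_ifs with hpq
    · have : ∑ i ∈ Finset.range a, ∑ j ∈ Finset.range b,
          jacobiSym (g (-A + i) (-B + j)) p * jacobiSym (g (-A + i) (-B + j)) q ≤
          ∑ i ∈ Finset.range a, ∑ j ∈ Finset.range b, 1 := by
        refine Finset.sum_le_sum fun i _ => Finset.sum_le_sum fun j _ => ?_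
        refine (le_abs_self _).trans ?_
        rw [abs_mul]
        exact mul_le_one₀ (abs_jacobiSym_le_one _ _) (abs_nonneg _) (abs_jacobiSym_le_one _ _)
      simp only [Finset.sum_const, Finset.card_range, nsmul_eq_mul, mul_one] at this
      linarith
    · have : NeZero p := ⟨pp.ne_zero⟩
      have : NeZero q := ⟨qp.ne_zero⟩
      simp only [← jacobiSym.mul_right]
      obtain ⟨t, ht⟩ := exists_jacobiSym_mul_eq_neg_one pp qp p2 hpq
      have hM : 0 < p * q := Nat.mul_pos pp.pos qp.pos
      have k1 := abs_sum_sum_periodic_le (f := fun u v => jacobiSym (g u v) (p * q)) hM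
        (fun u v => jacobiSym.mod_left' (hmod _ _ _ _ _ (Int.add_modEq_right) rfl))
        (fun u v => jacobiSym.mod_left' (hmod _ _ _ _ _ rfl (Int.add_modEq_right)))
        (fun u v => abs_jacobiSym_le_one _ _)
        (sum_sum_jacobiSym_eq_zero hhom hmod hM ht) (-A) (-B) a b
      refine (le_abs_self _).trans (k1.trans ?_)
      rw [zero_add]
      have : ((p * q : ℕ) : ℤ) ≤ Q ^ 2 := by
        rw [sq]; exact_mod_cast Nat.mul_le_mul pQ qQ
      exact mul_le_mul_of_nonneg_right this (by positivity)
  have h5 := Finset.sum_le_sum fun p hp => Finset.sum_le_sum (h4 p hp)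
  have h6 : ∑ p ∈ P, ∑ q ∈ P, ((if p = q then (a * b : ℤ) else 0) + Q ^ 2 * (a + b)) =
      P.card * (a * b) + P.card ^ 2 * (Q ^ 2 * (a + b)) := by
    simp only [Finset.sum_add_distrib, Finset.sum_ite_eq, Finset.sum_const, nsmul_eq_mul]
    rw [Finset.sum_congr rfl (fun p hp => if_pos hp)]
    simp only [Finset.sum_const, nsmul_eq_mul]
    ring
  rw [h6] at h5
  rw [h3] at h2
  have e1 : (2 * A + 1 : ℤ) = a := by rw [ha]; push_cast; ring
  have e2 : (2 * B + 1 : ℤ) = b := by rw [hb]; push_cast; ring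
  rw [e1, e2]
  linarith

/-! ### The sieve on one lattice and for one d. -/

theorem abs_le_floor_div_sqrt {u n N : ℤ} (hn : 0 < n) (hN : 0 ≤ N)
    (h : u ^ 2 * n ≤ 4 * N ^ 2) : |u| ≤ (⌊2 * (N : ℝ) / √(n : ℝ)⌋₊ : ℤ) := by
  have hn' : (0 : ℝ) < n := by exact_mod_cast hn
  have hN' : (0 : ℝ) ≤ N := by exact_mod_cast hN
  rw [Int.abs_eq_natAbs]
  refine Int.ofNat_le.mpr (Nat.le_floor ?_)
  rw [le_div_iff₀ (Real.sqrt_pos.mpr hn'), Nat.cast_natAbs, Int.cast_abs]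
  refine abs_le_of_sq_le_sq' ?_ (by positivity) |>.2
  rw [mul_pow, Real.sq_sqrt hn'.le, sq_abs, mul_pow]
  have : ((u ^ 2 * n : ℤ) : ℝ) ≤ ((4 * N ^ 2 : ℤ) : ℝ) := by exact_mod_cast h
  push_cast at this
  linarith

theorem two_mul_floor_add_one_le {x : ℝ} (hx : 0 ≤ x) : 2 * (⌊x⌋₊ : ℝ) + 1 ≤ 2 * x + 1 := by
  linarith [Nat.floor_le hx]

/-- The symbol of Y² is 1 except at primes dividing Y, which are at most half of P. -/
theorem card_le_two_mul_sum_jacobiSym_sq {P : Finset ℕ} (hP : ∀ p ∈ P, p.Prime) {Y : ℤ}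
    (hY : 2 * (P.filter fun p : ℕ => (p : ℤ) ∣ Y).card ≤ P.card) :
    (P.card : ℤ) ≤ 2 * ∑ p ∈ P, jacobiSym (Y ^ 2) p := by
  have h1 : ∑ p ∈ P, jacobiSym (Y ^ 2) p = ∑ p ∈ P, if (p : ℤ) ∣ Y then 0 else 1 := by
    refine Finset.sum_congr rfl fun p hp => ?_
    have hpp := Nat.prime_iff_prime_int.mp (hP p hp)
    have : NeZero p := ⟨(hP p hp).ne_zero⟩
    split_ifs with h
    · rw [jacobiSym.eq_zero_iff_not_coprime]
      intro h1
      have h2 := Int.isCoprime_iff_gcd_eq_one.mpr h1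
      exact hpp.not_isUnit (h2.isUnit_of_dvd' (dvd_pow h two_ne_zero) dvd_rfl)
    · refine jacobiSym.sq_one' (Int.isCoprime_iff_gcd_eq_one.mp ?_)
      exact ((Prime.coprime_iff_not_dvd hpp).mpr h).symm
  have h2 := Finset.card_filter_add_card_filter_not (s := P) (fun p : ℕ => (p : ℤ) ∣ Y)
  rw [h1, Finset.sum_ite]
  simp only [Finset.sum_const, nsmul_eq_mul]
  omega

/-- The points of one lattice at which `e` times the form is a square are sparse. -/
theorem exists_card_class_le (F : ℤ[X]) {w₀ : ℤ × ℤ} (hw₀ : IsCoprime w₀.1 w₀.2) {d : ℕ}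
    (hd : 0 < d) (hdw₀ : (d : ℤ) ∣ quinticForm F w₀.1 w₀.2) {e : ℤ} {N Q : ℕ}
    (hdN : 2 * d ≤ N ^ 2) {P : Finset ℕ} (hPne : P.Nonempty)
    (hP : ∀ p ∈ P, p.Prime ∧ 2 < p ∧ p ≤ Q) {S : Finset (ℤ × ℤ)}
    (hbd : ∀ w ∈ S, |w.1| ≤ N ∧ |w.2| ≤ N) (hcross : ∀ w ∈ S, (d : ℤ) ∣ cross w w₀)
    (hsq : ∀ w ∈ S, ∃ Y : ℤ, e * quinticForm F w.1 w.2 = Y ^ 2 ∧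
      2 * (P.filter fun p : ℕ => (p : ℤ) ∣ Y).card ≤ P.card) :
    ∃ b : ℤ × ℤ, 0 < sqNorm b ∧ sqNorm b ≤ 2 * d ∧ (d : ℤ) ∣ quinticForm F b.1 b.2 ∧
      (S.card : ℝ) ≤ 80 * (N ^ 2 / (d * P.card)) + 60 * (Q ^ 2 * N / √(sqNorm b : ℝ)) := by
  classical
  obtain ⟨b₁, b₂, h1, h2, h3, h4, h5⟩ := exists_reduced_basis hw₀ (d := (d : ℤ))
  set n₁ := sqNorm b₁ with hn₁
  set n₂ := sqNorm b₂ with hn₂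
  have hd' : (0 : ℤ) < d := by exact_mod_cast hd
  have hdet : (d : ℤ) ^ 2 ≤ n₁ * n₂ := by rw [← h3]; exact cross_sq_le _ _
  have hn₁pos : 0 < n₁ := by
    rcases (sqNorm_nonneg b₁).lt_or_eq with h | h
    · exact h
    · rw [← hn₁] at h; rw [← h] at hdet; nlinarith
  have hn₂pos : 0 < n₂ := hn₁pos.trans_le h4
  have hn₁le : n₁ ≤ 2 * d := by
    by_contra! h
    nlinarith
  refine ⟨b₁, hn₁pos, hn₁le, dvd_quinticForm_of_dvd_cross F hw₀ hdw₀ h1, ?_⟩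
  set A : ℕ := ⌊2 * ((N : ℤ) : ℝ) / √(n₁ : ℝ)⌋₊ with hA
  set B : ℕ := ⌊2 * ((N : ℤ) : ℝ) / √(n₂ : ℝ)⌋₊ with hB
  set lin : ℤ × ℤ → ℤ × ℤ := fun c => (c.1 * b₁.1 + c.2 * b₂.1, c.1 * b₁.2 + c.2 * b₂.2) with hlin
  set C := (Finset.Icc (-(A : ℤ)) A ×ˢ Finset.Icc (-(B : ℤ)) B).filter (fun c => lin c ∈ S) with hC
  have hSC : S.card ≤ C.card := by
    refine (Finset.card_le_card (t := C.image lin) fun w hw => ?_).trans Finset.card_image_le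
    obtain ⟨u, v, huv, hu, hv⟩ := exists_coordinates hw₀ hd'.ne' h1 h2 h3 (hcross w hw)
    refine Finset.mem_image.mpr ⟨(u, v), ?_, huv.symm⟩
    have hwN : sqNorm w ≤ 2 * (N : ℤ) ^ 2 := by
      obtain ⟨k1, k2⟩ := hbd w hw
      have := sq_le_sq.mpr (k1.trans (le_abs_self _))
      have := sq_le_sq.mpr (k2.trans (le_abs_self _))
      unfold sqNorm; linarith
    have hd2 : (0 : ℤ) < d ^ 2 := by positivity
    -- Cauchy–Schwarz and reducedness: d²u²n₁ ≤ |w|²n₂n₁ ≤ 2N² · (4/3)d², and 8/3 ≤ 4.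
    have hu2 : u ^ 2 * n₁ ≤ 4 * (N : ℤ) ^ 2 := by
      have k1 := cross_sq_le w b₂
      rw [hu] at k1
      have k2 : (d : ℤ) ^ 2 * (u ^ 2 * n₁) ≤ (d : ℤ) ^ 2 * (4 * (N : ℤ) ^ 2) := by
        have k3 := mul_le_mul_of_nonneg_right (k1.trans
          (mul_le_mul_of_nonneg_right hwN (sqNorm_nonneg b₂))) hn₁pos.le
        have k4 := mul_le_mul_of_nonneg_left h5 (sq_nonneg (N : ℤ))
        rw [← hn₂] at k3
        have : 0 ≤ (N : ℤ) ^ 2 * (d : ℤ) ^ 2 := by positivity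
        nlinarith
      exact le_of_mul_le_mul_left k2 hd2
    have hv2 : v ^ 2 * n₂ ≤ 4 * (N : ℤ) ^ 2 := by
      have k1 := cross_sq_le b₁ w
      rw [hv] at k1
      have k2 : (d : ℤ) ^ 2 * (v ^ 2 * n₂) ≤ (d : ℤ) ^ 2 * (4 * (N : ℤ) ^ 2) := by
        have k3 := mul_le_mul_of_nonneg_right (k1.trans
          (mul_le_mul_of_nonneg_left hwN (sqNorm_nonneg b₁))) hn₂pos.le
        have k4 := mul_le_mul_of_nonneg_left h5 (sq_nonneg (N : ℤ))
        rw [← hn₁] at k3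
        have : 0 ≤ (N : ℤ) ^ 2 * (d : ℤ) ^ 2 := by positivity
        nlinarith
      exact le_of_mul_le_mul_left k2 hd2
    have ku := abs_le.mp (abs_le_floor_div_sqrt hn₁pos (Int.natCast_nonneg N) hu2)
    have kv := abs_le.mp (abs_le_floor_div_sqrt hn₂pos (Int.natCast_nonneg N) hv2)
    rw [hC, Finset.mem_filter, Finset.mem_product, Finset.mem_Icc, Finset.mem_Icc]
    exact ⟨⟨ku, kv⟩, by rw [hlin]; simpa [← huv] using hw⟩
  have hsieve := square_sieve (g := fun u v => e * quinticForm F (lin (u, v)).1 (lin (u, v)).2)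
    (fun t u v => by
      simp only [hlin]
      rw [show t * u * b₁.1 + t * v * b₂.1 = t * (u * b₁.1 + v * b₂.1) by ring,
        show t * u * b₁.2 + t * v * b₂.2 = t * (u * b₁.2 + v * b₂.2) by ring, quinticForm_mul]
      ring)
    (fun n u v u' v' hu hv => by
      simp only [hlin]
      exact Int.ModEq.mul_left _ (quinticForm_modEq F
        ((hu.mul_right _).add (hv.mul_right _)) ((hu.mul_right _).add (hv.mul_right _))))
    hP (A := A) (B := B) (S := C)
    (fun s hs => by
      rw [hC, Finset.mem_filter, Finset.mem_product, Finset.mem_Icc, Finset.mem_Icc] at hs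
      exact ⟨abs_le.mpr hs.1.1, abs_le.mpr hs.1.2⟩)
    (fun s hs => by
      obtain ⟨Y, hY, hYP⟩ := hsq _ (Finset.mem_filter.mp hs).2
      simp only [hY]
      exact card_le_two_mul_sum_jacobiSym_sq (fun p hp => (hP p hp).1) hYP)
  set R : ℝ := (P.card : ℝ) with hR
  have hR1 : 1 ≤ R := by rw [hR]; exact_mod_cast hPne.card_pos
  have hQ1 : (1 : ℝ) ≤ Q := by
    obtain ⟨p, hp⟩ := hPne
    have := hP p hp
    exact_mod_cast (by omega : 1 ≤ Q)
  have hsieve' : (C.card : ℝ) * R ^ 2 ≤ 4 * (R * ((2 * A + 1) * (2 * B + 1)) +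
      R ^ 2 * (Q ^ 2 * ((2 * A + 1) + (2 * B + 1)))) := by rw [hR]; exact_mod_cast hsieve
  set s := √(n₁ : ℝ) with hs
  set r := √(n₂ : ℝ) with hr
  have hn₁R : (0 : ℝ) < n₁ := by exact_mod_cast hn₁pos
  have hspos : 0 < s := Real.sqrt_pos.mpr hn₁R
  have hsr : s ≤ r := Real.sqrt_le_sqrt (by exact_mod_cast h4)
  have hrpos : 0 < r := hspos.trans_le hsr
  have hdR : (0 : ℝ) < d := by exact_mod_cast hd
  have hdsr : (d : ℝ) ≤ s * r := by
    rw [hs, hr, ← Real.sqrt_mul hn₁R.le]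
    exact Real.le_sqrt_of_sq_le (by exact_mod_cast hdet)
  -- The shorter vector fits in the box, so the +1 in the long side is absorbed into 5N/s. The other
  -- vector may be longer than N, hence the +1 kept in `hb`.
  have hsN : s ≤ N := by
    rw [hs, Real.sqrt_le_left (by positivity)]
    have : n₁ ≤ (N : ℤ) ^ 2 := hn₁le.trans (by exact_mod_cast hdN)
    exact_mod_cast this
  have hN0 : (0 : ℝ) < N := hspos.trans_le hsN
  have ha : 2 * (A : ℝ) + 1 ≤ 5 * (N / s) := by
    have k1 := two_mul_floor_add_one_le (x := 2 * ((N : ℤ) : ℝ) / s) (by positivity)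
    have k2 : 1 ≤ (N : ℝ) / s := (one_le_div hspos).mpr hsN
    rw [Int.cast_natCast, mul_div_assoc] at k1
    rw [hA, Int.cast_natCast, mul_div_assoc]
    linarith
  have hb : 2 * (B : ℝ) + 1 ≤ 4 * (N / r) + 1 := by
    have k1 := two_mul_floor_add_one_le (x := 2 * ((N : ℤ) : ℝ) / r) (by positivity)
    rw [Int.cast_natCast, mul_div_assoc] at k1
    rw [hB, Int.cast_natCast, mul_div_assoc]
    linarith
  have hb' : 2 * (B : ℝ) + 1 ≤ 5 * (N / s) := by
    have k1 : (N : ℝ) / r ≤ N / s := by gcongr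
    have k2 : 1 ≤ (N : ℝ) / s := (one_le_div hspos).mpr hsN
    linarith
  have hab : (2 * (A : ℝ) + 1) * (2 * B + 1) ≤ 20 * (N ^ 2 / d) + 5 * (N / s) := by
    calc (2 * (A : ℝ) + 1) * (2 * B + 1) ≤ 5 * (N / s) * (4 * (N / r) + 1) := by gcongr
      _ = 20 * (N ^ 2 / (s * r)) + 5 * (N / s) := by field_simp; ring
      _ ≤ 20 * (N ^ 2 / d) + 5 * (N / s) := by gcongr
  have hR2 : 0 < R ^ 2 := by positivity
  have hfin : (C.card : ℝ) * R ^ 2 ≤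
      (80 * (N ^ 2 / (d * R)) + 60 * (Q ^ 2 * N / s)) * R ^ 2 := by
    refine hsieve'.trans ?_
    calc 4 * (R * ((2 * (A : ℝ) + 1) * (2 * B + 1)) +
          R ^ 2 * (Q ^ 2 * ((2 * A + 1) + (2 * B + 1))))
        ≤ 4 * (R * (20 * (N ^ 2 / d) + 5 * (N / s)) +
          R ^ 2 * (Q ^ 2 * (5 * (N / s) + 5 * (N / s)))) := by gcongr
      _ = 80 * (N ^ 2 / (d * R)) * R ^ 2 + (20 * R * 1 * (N / s) + 40 * R ^ 2 * Q ^ 2 * (N / s)) := by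
        field_simp; ring
      _ ≤ 80 * (N ^ 2 / (d * R)) * R ^ 2 + (20 * R ^ 2 * Q ^ 2 * (N / s) +
          40 * R ^ 2 * Q ^ 2 * (N / s)) := by
        gcongr
        · nlinarith
        · nlinarith
      _ = _ := by ring
  have := le_of_mul_le_mul_right hfin hR2
  exact (Nat.cast_le.mpr hSC).trans this

/-- A maximal set of pairwise unrelated elements, built greedily; transitivity is not needed. -/
theorem exists_representatives {α : Type*} (r : α → α → Prop) (hrefl : ∀ a, r a a)
    (hsymm : ∀ a b, r a b → r b a) (S : Finset α) :
    ∃ W ⊆ S, (∀ a ∈ W, ∀ b ∈ W, r a b → a = b) ∧ ∀ a ∈ S, ∃ b ∈ W, r a b := by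
  classical
  induction S using Finset.induction_on with
  | empty => exact ⟨∅, by simp⟩
  | insert a S _ ih =>
    obtain ⟨W, hWS, h1, h2⟩ := ih
    by_cases h : ∃ b ∈ W, r a b
    · refine ⟨W, hWS.trans (Finset.subset_insert _ _), h1, fun c hc => ?_⟩
      rcases Finset.mem_insert.mp hc with rfl | hc
      · exact h
      · exact h2 c hc
    · push Not at h
      refine ⟨insert a W, Finset.insert_subset_insert _ hWS, fun b hb c hc hbc => ?_,
        fun c hc => ?_⟩
      · rcases Finset.mem_insert.mp hb with rfl | hb' <;>
          rcases Finset.mem_insert.mp hc with rfl | hc'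
        · rfl
        · exact absurd hbc (h c hc')
        · exact absurd (hsymm _ _ hbc) (h b hb')
        · exact h1 b hb' c hc' hbc
      · rcases Finset.mem_insert.mp hc with rfl | hc
        · exact ⟨c, Finset.mem_insert_self _ _, hrefl c⟩
        · obtain ⟨b, hb, hcb⟩ := h2 c hc
          exact ⟨b, Finset.mem_insert_of_mem hb, hcb⟩

/-- The coprime points at which the form is divisible by the squarefree number `d` and `e` times
the form is a square. -/
theorem exists_card_le {F : ℤ[X]} (hF : F.natDegree = 5) {d : ℕ} (hd : Squarefree d) {e : ℤ}
    {N Q : ℕ} (hdN : 2 * d ≤ N ^ 2) {P : Finset ℕ} (hPne : P.Nonempty)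
    (hP : ∀ p ∈ P, p.Prime ∧ 2 < p ∧ p ≤ Q) {S : Finset (ℤ × ℤ)} (hSne : S.Nonempty)
    (hcop : ∀ w ∈ S, IsCoprime w.1 w.2) (hbd : ∀ w ∈ S, |w.1| ≤ N ∧ |w.2| ≤ N)
    (hdvd : ∀ w ∈ S, (d : ℤ) ∣ quinticForm F w.1 w.2)
    (hsq : ∀ w ∈ S, ∃ Y : ℤ, e * quinticForm F w.1 w.2 = Y ^ 2 ∧
      2 * (P.filter fun p : ℕ => (p : ℤ) ∣ Y).card ≤ P.card) :
    ∃ b : ℤ × ℤ, 0 < sqNorm b ∧ sqNorm b ≤ 2 * d ∧ (d : ℤ) ∣ quinticForm F b.1 b.2 ∧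
      (S.card : ℝ) ≤ (((F.coeff 5).natAbs + 6) ^ d.primeFactors.card : ℕ) *
        (80 * (N ^ 2 / (d * P.card)) + 60 * (Q ^ 2 * N / √(sqNorm b : ℝ))) := by
  classical
  obtain ⟨W, hWS, hW1, hW2⟩ := exists_representatives (fun w w' => (d : ℤ) ∣ cross w w')
    (fun w => by simp [cross, mul_comm])
    (fun w w' h => by
      have := dvd_neg.mpr h
      simp only [cross] at *
      rwa [neg_sub, mul_comm w.2, mul_comm w.1] at this) S
  have hWcard := card_le_pow_card_primeFactors hF hd W (fun w hw => hdvd w (hWS hw)) hW1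
  have hWne : W.Nonempty := by
    obtain ⟨w, hw⟩ := hSne
    obtain ⟨b, hb, -⟩ := hW2 w hw
    exact ⟨b, hb⟩
  -- The most populated class bounds all the others, so one short vector b suffices for each d.
  obtain ⟨w₀, hw₀, hmax⟩ := Finset.exists_max_image W
    (fun w₀ => (S.filter fun w => (d : ℤ) ∣ cross w w₀).card) hWne
  obtain ⟨b, hb1, hb2, hb3, hb4⟩ := exists_card_class_le F (hcop w₀ (hWS hw₀))
    (Nat.pos_of_ne_zero hd.ne_zero) (hdvd w₀ (hWS hw₀)) (e := e) hdN hPne hP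
    (S := S.filter fun w => (d : ℤ) ∣ cross w w₀)
    (fun w hw => hbd w (Finset.mem_filter.mp hw).1) (fun w hw => (Finset.mem_filter.mp hw).2)
    (fun w hw => hsq w (Finset.mem_filter.mp hw).1)
  refine ⟨b, hb1, hb2, hb3, ?_⟩
  have h1 : S.card ≤ W.card * (S.filter fun w => (d : ℤ) ∣ cross w w₀).card := by
    calc S.card ≤ (W.biUnion fun w₀ => S.filter fun w => (d : ℤ) ∣ cross w w₀).card := by
          refine Finset.card_le_card fun w hw => ?_
          obtain ⟨b, hb, hwb⟩ := hW2 w hw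
          exact Finset.mem_biUnion.mpr ⟨b, hb, Finset.mem_filter.mpr ⟨hw, hwb⟩⟩
      _ ≤ _ := Finset.card_biUnion_le_card_mul _ _ _ hmax
  calc (S.card : ℝ) ≤ ((W.card * (S.filter fun w => (d : ℤ) ∣ cross w w₀).card : ℕ) : ℝ) := by
        exact_mod_cast h1
    _ = (W.card : ℝ) * ((S.filter fun w => (d : ℤ) ∣ cross w w₀).card : ℝ) := by push_cast; rfl
    _ ≤ _ := by
      refine mul_le_mul (by exact_mod_cast hWcard) hb4 (by positivity) (by positivity)

/-! ### Divisor bounds and the sum over d. -/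

/-- A power of the number of squarefree divisors of `n` is smaller than any power of `n`. -/
theorem exists_pow_card_primeFactors_le (K : ℕ) (hK : 1 ≤ K) {ε : ℝ} (hε : 0 < ε) :
    ∃ C : ℝ, 1 ≤ C ∧ ∀ n : ℕ, n ≠ 0 →
      ((K ^ n.primeFactors.card : ℕ) : ℝ) ≤ C * (n : ℝ) ^ ε := by
  have hK1 : (1 : ℝ) ≤ K := by exact_mod_cast hK
  -- For p ≥ B the factor K is at most p^ε; fewer than B + 1 primes lie below B, and they contribute
  -- at most K^B.
  set B : ℕ := ⌈(K : ℝ) ^ (1 / ε)⌉₊ with hB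
  refine ⟨(K : ℝ) ^ B, one_le_pow₀ hK1, fun n hn => ?_⟩
  have h1 : ∀ p ∈ n.primeFactors, (K : ℝ) ≤ (if p < B then (K : ℝ) else 1) * (p : ℝ) ^ ε := by
    intro p hp
    have hp1 : (1 : ℝ) ≤ p := by exact_mod_cast (Nat.prime_of_mem_primeFactors hp).one_le
    split_ifs with h
    · exact le_mul_of_one_le_right (by positivity) (Real.one_le_rpow hp1 hε.le)
    · rw [one_mul]
      have h2 : (K : ℝ) ^ (1 / ε) ≤ p := (Nat.le_ceil _).trans (by exact_mod_cast not_lt.mp h)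
      have h3 := Real.rpow_le_rpow (by positivity) h2 hε.le
      rwa [← Real.rpow_mul (by positivity), one_div_mul_cancel hε.ne', Real.rpow_one] at h3
  calc ((K ^ n.primeFactors.card : ℕ) : ℝ) = ∏ _p ∈ n.primeFactors, (K : ℝ) := by
        rw [Finset.prod_const]; push_cast; rfl
    _ ≤ ∏ p ∈ n.primeFactors, ((if p < B then (K : ℝ) else 1) * (p : ℝ) ^ ε) :=
        Finset.prod_le_prod (fun _ _ => by positivity) h1
    _ = (∏ p ∈ n.primeFactors, if p < B then (K : ℝ) else 1) *
          (∏ p ∈ n.primeFactors, (p : ℝ)) ^ ε := by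
        rw [Finset.prod_mul_distrib, Real.finsetProd_rpow _ _ (fun _ _ => by positivity)]
    _ ≤ (K : ℝ) ^ B * (n : ℝ) ^ ε := by
        gcongr
        · rw [Finset.prod_ite, Finset.prod_const_one, mul_one, Finset.prod_const]
          refine pow_le_pow_right₀ hK1 ?_
          refine (Finset.card_le_card (t := Finset.range B) fun p hp => ?_).trans
            (Finset.card_range B).le
          exact Finset.mem_range.mpr (Finset.mem_filter.mp hp).2
        · rw [← Nat.cast_prod]
          exact_mod_cast Nat.le_of_dvd (Nat.pos_of_ne_zero hn) (Nat.prod_primeFactors_dvd n)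

theorem card_squarefree_dvd_le (T : Finset ℕ) {n : ℕ} (hn : n ≠ 0)
    (hT : ∀ d ∈ T, Squarefree d ∧ d ∣ n) : T.card ≤ 2 ^ n.primeFactors.card := by
  rw [← Finset.card_powerset]
  refine Finset.card_le_card_of_injOn Nat.primeFactors (fun d hd => ?_) fun d hd d' hd' h => ?_
  · exact Finset.mem_coe.mpr (Finset.mem_powerset.mpr (Nat.primeFactors_mono (hT d hd).2 hn))
  · rw [← Nat.prod_primeFactors_of_squarefree (hT d hd).1,
      ← Nat.prod_primeFactors_of_squarefree (hT d' hd').1, h]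

/-- For x ≠ 0 there are at most 2|x| + 1 ≤ 3|x| values of z, so each x contributes at most 3. -/
theorem sum_ite_abs_le_inv_le (X : ℕ) :
    ∑ x ∈ Finset.Icc (-(X : ℤ)) X, ∑ z ∈ Finset.Icc (-(X : ℤ)) X,
      (if x ≠ 0 ∧ |z| ≤ |x| then (1 : ℝ) / |(x : ℝ)| else 0) ≤ 3 * (2 * X + 1) := by
  have h1 : ∀ x ∈ Finset.Icc (-(X : ℤ)) X, ∑ z ∈ Finset.Icc (-(X : ℤ)) X,
      (if x ≠ 0 ∧ |z| ≤ |x| then (1 : ℝ) / |(x : ℝ)| else 0) ≤ 3 := by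
    intro x hx
    by_cases hx0 : x = 0
    · simp [hx0]
    · rw [← Finset.sum_filter, Finset.sum_const, nsmul_eq_mul]
      have h2 : ((Finset.Icc (-(X : ℤ)) X).filter fun z => x ≠ 0 ∧ |z| ≤ |x|) ⊆
          Finset.Icc (-|x|) |x| := fun z hz =>
        Finset.mem_Icc.mpr (abs_le.mp (Finset.mem_filter.mp hz).2.2)
      have h3 := Finset.card_le_card h2
      rw [Int.card_Icc] at h3
      have h4 : 1 ≤ |x| := Int.one_le_abs hx0
      have h5 : ((((Finset.Icc (-(X : ℤ)) X).filter fun z => x ≠ 0 ∧ |z| ≤ |x|).card : ℕ) : ℤ) ≤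
          3 * |x| := by omega
      have h6 : ((((Finset.Icc (-(X : ℤ)) X).filter fun z => x ≠ 0 ∧ |z| ≤ |x|).card : ℕ) : ℝ) ≤
          3 * |(x : ℝ)| := by exact_mod_cast h5
      have h7 : (0 : ℝ) < |(x : ℝ)| := by positivity
      rw [mul_one_div, div_le_iff₀ h7]
      exact h6
  refine (Finset.sum_le_card_nsmul _ _ _ h1).trans ?_
  rw [Int.card_Icc, nsmul_eq_mul]
  have : (((X : ℤ) + 1 - -(X : ℤ)).toNat : ℝ) = 2 * X + 1 := by
    have : ((X : ℤ) + 1 - -(X : ℤ)).toNat = 2 * X + 1 := by omega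
    rw [this]; push_cast; ring
  rw [this]; linarith

/-- The length is at least the larger coordinate in absolute value. The two cases give 2 · 3(2X + 1)
≤ 18X. -/
theorem sum_inv_sqrt_sqNorm_le {X : ℕ} (hX : 1 ≤ X) (T : Finset (ℤ × ℤ))
    (hT : ∀ b ∈ T, 0 < sqNorm b ∧ sqNorm b ≤ X ^ 2) :
    ∑ b ∈ T, 1 / √(sqNorm b : ℝ) ≤ 18 * X := by
  set f : ℤ → ℤ → ℝ := fun x z => if x ≠ 0 ∧ |z| ≤ |x| then (1 : ℝ) / |(x : ℝ)| else 0 with hf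
  have hf0 : ∀ x z, 0 ≤ f x z := fun x z => by rw [hf]; dsimp only; split_ifs <;> positivity
  have h1 : ∀ b ∈ T, 1 / √(sqNorm b : ℝ) ≤ f b.1 b.2 + f b.2 b.1 := by
    rintro ⟨x, z⟩ hb
    have hpos := (hT _ hb).1
    have aux : ∀ x z : ℤ, x ≠ 0 → 1 / √(sqNorm (x, z) : ℝ) ≤ 1 / |(x : ℝ)| := by
      intro x z hx
      have : (0 : ℝ) < |(x : ℝ)| := by positivity
      apply one_div_le_one_div_of_le this
      refine Real.le_sqrt_of_sq_le ?_
      rw [sq_abs]; simp only [sqNorm]; push_cast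
      nlinarith [sq_nonneg (z : ℝ)]
    rcases le_total |z| |x| with h | h
    · have hx : x ≠ 0 := by
        rintro rfl
        have : z = 0 := by simpa using h
        simp [sqNorm, this] at hpos
      have e : f x z = 1 / |(x : ℝ)| := by rw [hf]; exact if_pos ⟨hx, h⟩
      have := aux x z hx
      have := hf0 z x
      simp only at *; linarith
    · have hz : z ≠ 0 := by
        rintro rfl
        have : x = 0 := by simpa using h
        simp [sqNorm, this] at hpos
      have e : f z x = 1 / |(z : ℝ)| := by rw [hf]; exact if_pos ⟨hz, h⟩
      have h2 := aux z x hz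
      have h3 : sqNorm (z, x) = sqNorm (x, z) := by simp only [sqNorm]; ring
      have := hf0 x z
      rw [h3] at h2
      simp only at *; linarith
  have h2 : T ⊆ Finset.Icc (-(X : ℤ)) X ×ˢ Finset.Icc (-(X : ℤ)) X := by
    intro b hb
    have h3 := (hT b hb).2
    have h4 : |b.1| ≤ X := abs_le_of_sq_le_sq (by unfold sqNorm at h3; nlinarith) (by positivity)
    have h5 : |b.2| ≤ X := abs_le_of_sq_le_sq (by unfold sqNorm at h3; nlinarith) (by positivity)
    exact Finset.mem_product.mpr ⟨Finset.mem_Icc.mpr (abs_le.mp h4),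
      Finset.mem_Icc.mpr (abs_le.mp h5)⟩
  have h3 := sum_ite_abs_le_inv_le X
  have hX' : (1 : ℝ) ≤ X := by exact_mod_cast hX
  calc ∑ b ∈ T, 1 / √(sqNorm b : ℝ) ≤ ∑ b ∈ T, (f b.1 b.2 + f b.2 b.1) := Finset.sum_le_sum h1
    _ ≤ ∑ b ∈ Finset.Icc (-(X : ℤ)) X ×ˢ Finset.Icc (-(X : ℤ)) X, (f b.1 b.2 + f b.2 b.1) :=
      Finset.sum_le_sum_of_subset_of_nonneg h2 fun b _ _ => add_nonneg (hf0 _ _) (hf0 _ _)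
    _ = (∑ x ∈ Finset.Icc (-(X : ℤ)) X, ∑ z ∈ Finset.Icc (-(X : ℤ)) X, f x z) +
        ∑ x ∈ Finset.Icc (-(X : ℤ)) X, ∑ z ∈ Finset.Icc (-(X : ℤ)) X, f x z := by
      rw [Finset.sum_add_distrib, Finset.sum_product, Finset.sum_product_right]
    _ ≤ 18 * X := by linarith

theorem sum_one_div_Icc_le (D : ℕ) :
    ∑ d ∈ Finset.Icc 1 D, (1 : ℝ) / d ≤ 1 + Real.log D := by
  have h := harmonic_le_one_add_log D
  rw [harmonic_eq_sum_Icc] at h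
  push_cast at h
  simpa using h

/-- The points at which the form is `σ d t²` with a small squarefree `d`. -/
theorem card_small_squarefree_part_le {F : ℤ[X]} (hF : F.natDegree = 5)
    (hne : ∀ x z : ℤ, x ≠ 0 ∨ z ≠ 0 → quinticForm F x z ≠ 0) {N D Q X : ℕ} (hX : 1 ≤ X)
    (hDX : 2 * D ≤ X ^ 2) (hDN : 2 * D ≤ N ^ 2) {P : Finset ℕ} (hPne : P.Nonempty)
    (hP : ∀ p ∈ P, p.Prime ∧ 2 < p ∧ p ≤ Q) {κ₁ κ₂ : ℝ} (hκ₁0 : 0 ≤ κ₁) (hκ₂0 : 0 ≤ κ₂)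
    (hκ₁ : ∀ d ∈ Finset.Icc 1 D,
      (((F.coeff 5).natAbs + 6) ^ d.primeFactors.card : ℕ) ≤ κ₁)
    (hκ₂ : ∀ b : ℤ × ℤ, 0 < sqNorm b → sqNorm b ≤ 2 * D →
      ((2 ^ (quinticForm F b.1 b.2).natAbs.primeFactors.card : ℕ) : ℝ) ≤ κ₂)
    {σ : ℤ} (hσ : σ ^ 2 = 1) {U : Finset (ℤ × ℤ)}
    (hcop : ∀ w ∈ U, IsCoprime w.1 w.2) (hbd : ∀ w ∈ U, |w.1| ≤ N ∧ |w.2| ≤ N)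
    (hU : ∀ w ∈ U, ∃ d ∈ Finset.Icc 1 D, Squarefree d ∧ ∃ t : ℤ,
      quinticForm F w.1 w.2 = σ * d * t ^ 2 ∧
      2 * (P.filter fun p : ℕ => (p : ℤ) ∣ d * t).card ≤ P.card) :
    (U.card : ℝ) ≤ κ₁ * (80 * (N ^ 2 / P.card * (1 + Real.log D)) +
      60 * (Q ^ 2 * N * (κ₂ * (18 * X)))) := by
  classical
  set S : ℕ → Finset (ℤ × ℤ) := fun d => U.filter fun w => ∃ t : ℤ,
      quinticForm F w.1 w.2 = σ * d * t ^ 2 ∧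
      2 * (P.filter fun p : ℕ => (p : ℤ) ∣ d * t).card ≤ P.card with hS
  set E := (Finset.Icc 1 D).filter fun d => Squarefree d ∧ (S d).Nonempty with hE
  have hUS : U.card ≤ ∑ d ∈ E, (S d).card := by
    refine (Finset.card_le_card (t := E.biUnion S) fun w hw => ?_).trans Finset.card_biUnion_le
    obtain ⟨d, hd, hsf, t, ht⟩ := hU w hw
    have hwS : w ∈ S d := Finset.mem_filter.mpr ⟨hw, t, ht⟩
    exact Finset.mem_biUnion.mpr ⟨d, Finset.mem_filter.mpr ⟨hd, hsf, w, hwS⟩, hwS⟩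
  have hEd : ∀ d ∈ E, 1 ≤ d ∧ d ≤ D ∧ Squarefree d ∧ (S d).Nonempty := fun d hd => by
    obtain ⟨h1, h2, h3⟩ := Finset.mem_filter.mp hd
    exact ⟨(Finset.mem_Icc.mp h1).1, (Finset.mem_Icc.mp h1).2, h2, h3⟩
  have hb : ∀ d : ℕ, ∃ b : ℤ × ℤ, d ∈ E → 0 < sqNorm b ∧ sqNorm b ≤ 2 * d ∧
      (d : ℤ) ∣ quinticForm F b.1 b.2 ∧
      ((S d).card : ℝ) ≤ (((F.coeff 5).natAbs + 6) ^ d.primeFactors.card : ℕ) *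
        (80 * (N ^ 2 / (d * P.card)) + 60 * (Q ^ 2 * N / √(sqNorm b : ℝ))) := by
    intro d
    by_cases hd : d ∈ E
    · obtain ⟨-, hdD, hsf, hne'⟩ := hEd d hd
      have hmem : ∀ w ∈ S d, w ∈ U := fun w hw => (Finset.mem_filter.mp hw).1
      -- The multiplier σd turns the value σ d t² into the square (d t)².
      obtain ⟨b, hb⟩ := exists_card_le hF hsf (e := σ * d) (N := N) (Q := Q) (by omega) hPne hP hne'
        (fun w hw => hcop w (hmem w hw)) (fun w hw => hbd w (hmem w hw))
        (fun w hw => by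
          obtain ⟨t, ht, -⟩ := (Finset.mem_filter.mp hw).2
          exact ⟨σ * t ^ 2, by rw [ht]; ring⟩)
        (fun w hw => by
          obtain ⟨t, ht, h2⟩ := (Finset.mem_filter.mp hw).2
          exact ⟨d * t, by rw [ht]; linear_combination (d : ℤ) ^ 2 * t ^ 2 * hσ, h2⟩)
      exact ⟨b, fun _ => hb⟩
    · exact ⟨0, fun h => absurd h hd⟩
  choose b hb using hb
  have hκ₂' : ∀ c ∈ E.image b, 0 < sqNorm c ∧ sqNorm c ≤ 2 * D := by
    intro c hc
    obtain ⟨d, hd, rfl⟩ := Finset.mem_image.mp hc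
    have h1 : (d : ℤ) ≤ D := by exact_mod_cast (hEd d hd).2.1
    exact ⟨(hb d hd).1, by linarith [(hb d hd).2.1]⟩
  have hsum1 : ∑ d ∈ E, (N : ℝ) ^ 2 / (d * P.card) ≤ N ^ 2 / P.card * (1 + Real.log D) := by
    calc ∑ d ∈ E, (N : ℝ) ^ 2 / (d * P.card) ≤
          ∑ d ∈ Finset.Icc 1 D, (N : ℝ) ^ 2 / (d * P.card) :=
          Finset.sum_le_sum_of_subset_of_nonneg (Finset.filter_subset _ _)
            fun _ _ _ => by positivity
      _ = N ^ 2 / P.card * ∑ d ∈ Finset.Icc 1 D, (1 : ℝ) / d := by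
          rw [Finset.mul_sum]
          refine Finset.sum_congr rfl fun d _ => ?_
          rw [div_mul_div_comm, mul_one, mul_comm (d : ℝ)]
      _ ≤ _ := by gcongr; exact sum_one_div_Icc_le D
  -- Group the d by their short vector c. All d in one group are squarefree divisors of the nonzero
  -- value at c, so there are at most κ₂ of them.
  have hsum2 : ∑ d ∈ E, 1 / √(sqNorm (b d) : ℝ) ≤ κ₂ * (18 * X) := by
    calc ∑ d ∈ E, 1 / √(sqNorm (b d) : ℝ)
        = ∑ c ∈ E.image b, ∑ d ∈ E.filter (fun d => b d = c), 1 / √(sqNorm (b d) : ℝ) :=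
          (Finset.sum_fiberwise_of_maps_to (fun d hd => Finset.mem_image_of_mem b hd) _).symm
      _ ≤ ∑ c ∈ E.image b, κ₂ * (1 / √(sqNorm c : ℝ)) := by
          refine Finset.sum_le_sum fun c hc => ?_
          have h1 : ∑ d ∈ E.filter (fun d => b d = c), 1 / √(sqNorm (b d) : ℝ) =
              ∑ d ∈ E.filter (fun d => b d = c), 1 / √(sqNorm c : ℝ) :=
            Finset.sum_congr rfl fun d hd => by rw [(Finset.mem_filter.mp hd).2]
          rw [h1, Finset.sum_const, nsmul_eq_mul]
          gcongr
          obtain ⟨k1, k2⟩ := hκ₂' c hc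
          refine le_trans ?_ (hκ₂ c k1 k2)
          refine Nat.cast_le.mpr (card_squarefree_dvd_le _ ?_ fun d hd => ?_)
          · rw [Int.natAbs_ne_zero]
            refine hne _ _ ?_
            by_contra! h
            simp [sqNorm, h.1, h.2] at k1
          · obtain ⟨hdE, rfl⟩ := Finset.mem_filter.mp hd
            exact ⟨(hEd d hdE).2.2.1, Int.natCast_dvd.mp (hb d hdE).2.2.1⟩
      _ = κ₂ * ∑ c ∈ E.image b, 1 / √(sqNorm c : ℝ) := by rw [Finset.mul_sum]
      _ ≤ κ₂ * (18 * X) := by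
          gcongr
          refine sum_inv_sqrt_sqNorm_le hX _ fun c hc => ?_
          obtain ⟨k1, k2⟩ := hκ₂' c hc
          exact ⟨k1, k2.trans (by exact_mod_cast hDX)⟩
  calc (U.card : ℝ) ≤ ∑ d ∈ E, ((S d).card : ℝ) := by exact_mod_cast hUS
    _ ≤ ∑ d ∈ E, κ₁ * (80 * (N ^ 2 / (d * P.card)) +
          60 * (Q ^ 2 * N * (1 / √(sqNorm (b d) : ℝ)))) := by
        refine Finset.sum_le_sum fun d hd => ((hb d hd).2.2.2).trans ?_
        rw [mul_one_div]
        gcongr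
        exact hκ₁ d (Finset.mem_filter.mp hd).1
    _ = κ₁ * (80 * ∑ d ∈ E, (N : ℝ) ^ 2 / (d * P.card) +
          60 * (Q ^ 2 * N * ∑ d ∈ E, 1 / √(sqNorm (b d) : ℝ))) := by
        simp only [Finset.mul_sum, ← Finset.sum_add_distrib]
    _ ≤ _ := by gcongr

/-! ### Very large primes: choice of parameters. -/

/-- Chebyshev's lower bound at x = y^6, with log x ≤ y, gives at least y^5 / 2 primes, more than
enough even after 2 is removed. -/
theorem eventually_exists_primes :
    ∀ᶠ y : ℝ in Filter.atTop, ∃ P : Finset ℕ,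
      (∀ p ∈ P, p.Prime ∧ 2 < p ∧ p ≤ ⌊y ^ 6⌋₊) ∧ y ^ 4 ≤ P.card := by
  have hlog := (Real.isLittleO_log_id_atTop).bound (show (0 : ℝ) < 1 / 6 by norm_num)
  filter_upwards [hlog, Filter.eventually_ge_atTop 4] with y hy hy4
  have hy0 : 0 < y := by linarith
  have hlogy : Real.log y ≤ y / 6 := by
    have := (le_abs_self _).trans hy
    rw [id, Real.norm_of_nonneg hy0.le] at this
    linarith
  set x := y ^ 6 with hx
  have hy6 : 4 ^ 5 * y ≤ y ^ 6 := by
    have : (4 : ℝ) ^ 5 ≤ y ^ 5 := by gcongr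
    nlinarith
  have hx1 : 1 < x := by linarith
  have hlogx : Real.log x ≤ y := by
    rw [hx, Real.log_pow]; push_cast; linarith
  have hlogx0 : 0 < Real.log x := Real.log_pos hx1
  have hlogx2 : Real.log (x + 2) ≤ 2 * y := by
    have h1 : Real.log (x + 2) ≤ Real.log (x ^ 2) :=
      Real.log_le_log (by linarith) (by nlinarith)
    rw [Real.log_pow] at h1
    push_cast at h1
    linarith
  have hpi := Chebyshev.pi_ge' hx1
  have h1 : y ^ 4 + 2 ≤ ((x - 1) * Real.log 2 - Real.log (x + 2)) / Real.log x := by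
    rw [le_div_iff₀ hlogx0]
    have h2 : x / 2 ≤ (x - 1) * Real.log 2 - Real.log (x + 2) := by
      have := Real.log_two_gt_d9
      nlinarith
    have h3 : (y ^ 4 + 2) * Real.log x ≤ (y ^ 4 + 2) * y := by gcongr
    have h4 : (y ^ 4 + 2) * y ≤ x / 2 := by
      have h5 : y ^ 5 * 4 ≤ y ^ 6 := by
        have : 0 ≤ y ^ 5 := by positivity
        nlinarith
      have h6 : y * 4 ^ 4 ≤ y ^ 5 := by
        have : (4 : ℝ) ^ 4 ≤ y ^ 4 := by gcongr
        nlinarith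
      rw [hx]; nlinarith
    linarith
  refine ⟨(Nat.primesLE ⌊x⌋₊).erase 2, fun p hp => ?_, ?_⟩
  · obtain ⟨hp2, hp⟩ := Finset.mem_erase.mp hp
    rw [Nat.mem_primesLE] at hp
    exact ⟨hp.2, lt_of_le_of_ne hp.2.two_le (Ne.symm hp2), hp.1⟩
  · have h2 : (Nat.primesLE ⌊x⌋₊).card = Nat.primeCounting ⌊x⌋₊ := Nat.primesLE_card_eq_primeCounting _
    have h3 := Finset.pred_card_le_card_erase (s := Nat.primesLE ⌊x⌋₊) (a := 2)
    have h4 : (Nat.primeCounting ⌊x⌋₊ : ℝ) ≤ ((Nat.primesLE ⌊x⌋₊).erase 2).card + 1 := by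
      rw [← h2]; exact_mod_cast (by omega)
    linarith

/-- The crude step ω ≤ 2^ω lets the divisor bound be reused. -/
theorem card_filter_dvd_le {P : Finset ℕ} (hP : ∀ p ∈ P, p.Prime) {Y : ℤ} (hY : Y ≠ 0) :
    (P.filter fun p : ℕ => (p : ℤ) ∣ Y).card ≤ 2 ^ Y.natAbs.primeFactors.card := by
  refine (Finset.card_le_card (t := Y.natAbs.primeFactors) fun p hp => ?_).trans
    Nat.lt_two_pow_self.le
  obtain ⟨h1, h2⟩ := Finset.mem_filter.mp hp
  exact Nat.mem_primeFactors.mpr ⟨hP p h1, Int.natCast_dvd.mp h2, Int.natAbs_ne_zero.mpr hY⟩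

theorem exists_squarefree_part (n : ℤ) :
    ∃ d : ℕ, Squarefree d ∧ ∃ b : ℤ, n = n.sign * d * b ^ 2 := by
  obtain ⟨d, b, h, hd⟩ := Nat.sq_mul_squarefree n.natAbs
  refine ⟨d, hd, b, ?_⟩
  conv_lhs => rw [← Int.sign_mul_natAbs n, ← h]
  push_cast; ring

/-- Few points have a value divisible by the square of a very large prime. -/
theorem exists_eventually_card_huge_prime_le {F : ℤ[X]} (hF : F.natDegree = 5)
    (hne : ∀ x z : ℤ, x ≠ 0 ∨ z ≠ 0 → quinticForm F x z ≠ 0) :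
    ∃ C : ℝ, ∀ᶠ y : ℝ in Filter.atTop, ∀ N : ℕ, (N : ℝ) = y ^ 40 → ∀ U : Finset (ℤ × ℤ),
      (∀ w ∈ U, IsCoprime w.1 w.2) → (∀ w ∈ U, |w.1| ≤ N ∧ |w.2| ≤ N) →
      (∀ w ∈ U, ∃ p : ℕ, y ^ 76 < p ∧ (p : ℤ) ^ 2 ∣ quinticForm F w.1 w.2) →
      (U.card : ℝ) ≤ C * y ^ 78 := by
  classical
  obtain ⟨H, hH1, hH⟩ := exists_quinticForm_bound F
  -- The exponents 1/80 and 1/200 match d ≤ y^80 and form values up to H y^200, so each divisor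
  -- bound costs one factor y.
  obtain ⟨C₁, hC₁1, hC₁⟩ := exists_pow_card_primeFactors_le ((F.coeff 5).natAbs + 6) (by omega)
    (ε := 1 / 80) (by norm_num)
  obtain ⟨C₂, hC₂1, hC₂⟩ := exists_pow_card_primeFactors_le 2 (by omega)
    (ε := 1 / 200) (by norm_num)
  refine ⟨2 * (C₁ * (80 * 81 + 60 * (C₂ * H * (18 * (3 * H))))), ?_⟩
  filter_upwards [eventually_exists_primes, Filter.eventually_ge_atTop (4 * (C₂ * H))]
    with y ⟨P, hP, hPy⟩ hy N hN U hcop hbd hU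
  have hCH1 : 1 ≤ C₂ * H := one_le_mul_of_one_le_of_one_le hC₂1 hH1
  have hy1 : 1 ≤ y := by linarith
  have hHy : 4 * H ≤ y := by nlinarith
  have hy0 : 0 < y := by linarith
  have hbdR : ∀ w ∈ U, |(w.1 : ℝ)| ≤ y ^ 40 ∧ |(w.2 : ℝ)| ≤ y ^ 40 := fun w hw => by
    rw [← hN]; exact ⟨by exact_mod_cast (hbd w hw).1, by exact_mod_cast (hbd w hw).2⟩
  have hFne : ∀ w ∈ U, quinticForm F w.1 w.2 ≠ 0 := fun w hw => by
    refine hne _ _ ?_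
    by_contra! h
    have := hcop w hw
    rw [h.1, h.2] at this
    exact not_isCoprime_zero_zero this
  -- A value of size at most H y^200 divided by p² > y^152.
  set D : ℕ := ⌊H * y ^ 48⌋₊ with hD
  have hDle : (D : ℝ) ≤ H * y ^ 48 := Nat.floor_le (by positivity)
  have hDN : 2 * D ≤ N ^ 2 := by
    have : 2 * (D : ℝ) ≤ (N : ℝ) ^ 2 := by
      rw [hN]
      calc 2 * (D : ℝ) ≤ y * y ^ 48 := by nlinarith [show 0 < y ^ 48 by positivity]
        _ = y ^ 49 := by ring
        _ ≤ y ^ 80 := pow_le_pow_right₀ hy1 (by norm_num)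
        _ = (y ^ 40) ^ 2 := by ring
    exact_mod_cast this
  have hDy : (D : ℝ) ≤ y ^ 80 := by
    have : 2 * (D : ℝ) ≤ (N : ℝ) ^ 2 := by exact_mod_cast hDN
    rw [hN] at this
    have h2 : (y ^ 40) ^ 2 = y ^ 80 := by ring
    have : (0 : ℝ) ≤ D := Nat.cast_nonneg _
    linarith
  set X : ℕ := ⌈2 * H * y ^ 24⌉₊ with hX
  have hXge : 2 * H * y ^ 24 ≤ X := Nat.le_ceil _
  have hXle : (X : ℝ) ≤ 3 * H * y ^ 24 := by
    have h1 := (Nat.ceil_lt_add_one (show 0 ≤ 2 * H * y ^ 24 by positivity)).le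
    have h2 : 1 ≤ H * y ^ 24 := one_le_mul_of_one_le_of_one_le hH1 (one_le_pow₀ hy1)
    rw [← hX] at h1
    linarith
  have hX1 : 1 ≤ X := by
    have : (0 : ℝ) < X := lt_of_lt_of_le (by positivity) hXge
    exact_mod_cast this
  have hDX : 2 * D ≤ X ^ 2 := by
    have : 2 * (D : ℝ) ≤ (X : ℝ) ^ 2 := by
      calc 2 * (D : ℝ) ≤ 2 * (H * y ^ 48) := by linarith
        _ ≤ 4 * H * (H * y ^ 48) := by
          have : 0 < H * y ^ 48 := by positivity
          nlinarith
        _ = (2 * H * y ^ 24) ^ 2 := by ring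
        _ ≤ _ := by gcongr
    exact_mod_cast this
  have hF200 : ∀ n : ℤ, |(n : ℝ)| ≤ H * y ^ 200 → n ≠ 0 →
      ((2 ^ n.natAbs.primeFactors.card : ℕ) : ℝ) ≤ C₂ * H * y := by
    intro n hn hn0
    refine (hC₂ _ (Int.natAbs_ne_zero.mpr hn0)).trans ?_
    rw [Nat.cast_natAbs, Int.cast_abs, mul_assoc]
    gcongr
    calc |(n : ℝ)| ^ (1 / 200 : ℝ) ≤ (H ^ 200 * y ^ 200) ^ (1 / 200 : ℝ) := by
          refine Real.rpow_le_rpow (abs_nonneg _) (hn.trans ?_) (by norm_num)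
          gcongr
          exact le_self_pow₀ hH1 (by norm_num)
      _ = H * y := by
          rw [← mul_pow, ← Real.rpow_natCast, ← Real.rpow_mul (by positivity)]
          norm_num
  have hκ₁ : ∀ d ∈ Finset.Icc 1 D,
      ((((F.coeff 5).natAbs + 6) ^ d.primeFactors.card : ℕ) : ℝ) ≤ C₁ * y := by
    intro d hd
    obtain ⟨h1, h2⟩ := Finset.mem_Icc.mp hd
    refine (hC₁ d (by omega)).trans ?_
    gcongr
    calc (d : ℝ) ^ (1 / 80 : ℝ) ≤ (y ^ 80) ^ (1 / 80 : ℝ) := by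
          refine Real.rpow_le_rpow (by positivity) (le_trans ?_ hDy) (by norm_num)
          exact_mod_cast h2
      _ = y := by
          rw [← Real.rpow_natCast, ← Real.rpow_mul (by positivity)]
          norm_num
  have hκ₂ : ∀ b : ℤ × ℤ, 0 < sqNorm b → sqNorm b ≤ 2 * D →
      ((2 ^ (quinticForm F b.1 b.2).natAbs.primeFactors.card : ℕ) : ℝ) ≤ C₂ * H * y := by
    intro b hb1 hb2
    have hb3 : sqNorm b ≤ (N : ℤ) ^ 2 := hb2.trans (by exact_mod_cast hDN)
    have h4 : |b.1| ≤ N := abs_le_of_sq_le_sq (by unfold sqNorm at hb3; nlinarith) (by positivity)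
    have h5 : |b.2| ≤ N := abs_le_of_sq_le_sq (by unfold sqNorm at hb3; nlinarith) (by positivity)
    refine hF200 _ ?_ (hne _ _ ?_)
    · have := hH b.1 b.2 (y ^ 40) (by rw [← hN]; exact_mod_cast h4)
        (by rw [← hN]; exact_mod_cast h5)
      rwa [← pow_mul] at this
    · by_contra! h
      simp [sqNorm, h.1, h.2] at hb1
  have hlogD : 1 + Real.log D ≤ 81 * y := by
    rcases Nat.eq_zero_or_pos D with h0 | h0
    · rw [h0]; simp; linarith
    · have h1 : Real.log D ≤ Real.log (y ^ 80) := Real.log_le_log (by exact_mod_cast h0) hDy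
      rw [Real.log_pow] at h1
      have h2 := Real.log_le_self hy0.le
      push_cast at h1
      linarith
  have hRpos : 0 < (P.card : ℝ) := lt_of_lt_of_le (by positivity) hPy
  have hPne : P.Nonempty := by
    rw [← Finset.card_pos]; exact_mod_cast hRpos
  have hQ : ((⌊y ^ 6⌋₊ : ℕ) : ℝ) ≤ y ^ 6 := Nat.floor_le (by positivity)
  have hdecomp : ∀ w ∈ U, ∃ d ∈ Finset.Icc 1 D, Squarefree d ∧ ∃ t : ℤ,
      quinticForm F w.1 w.2 = (quinticForm F w.1 w.2).sign * d * t ^ 2 ∧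
      2 * (P.filter fun p : ℕ => (p : ℤ) ∣ d * t).card ≤ P.card := by
    intro w hw
    obtain ⟨p, hp, m, hm⟩ := hU w hw
    have hF0 := hFne w hw
    have hFle := hH w.1 w.2 _ (hbdR w hw).1 (hbdR w hw).2
    rw [← pow_mul] at hFle
    have hm0 : m ≠ 0 := by rintro rfl; exact hF0 (by rw [hm, mul_zero])
    have hp0 : (0 : ℝ) < p := lt_trans (by positivity) hp
    have hpZ : (0 : ℤ) < p := by exact_mod_cast hp0
    -- The squarefree part is taken of the cofactor m of p², and p goes into t = p b; this is what
    -- keeps d small.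
    obtain ⟨d, hd, b, hb⟩ := exists_squarefree_part m
    have hb0 : b ≠ 0 := by rintro rfl; apply hm0; rw [hb]; ring
    have hd1 : 1 ≤ d := Nat.one_le_iff_ne_zero.mpr hd.ne_zero
    have hsign : (quinticForm F w.1 w.2).sign = m.sign := by
      rw [hm, Int.sign_mul, Int.sign_eq_one_of_pos (by positivity), one_mul]
    have heq : quinticForm F w.1 w.2 = m.sign * d * (p * b) ^ 2 := by
      rw [hm]; nth_rewrite 1 [hb]; ring
    have habs : |(quinticForm F w.1 w.2 : ℝ)| = d * (p ^ 2 * b ^ 2) := by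
      rw [← Int.cast_abs, heq, abs_mul, abs_mul, Int.abs_sign_of_ne_zero hm0, one_mul,
        abs_of_nonneg (Int.natCast_nonneg d), abs_of_nonneg (sq_nonneg _)]
      push_cast; ring
    have hb1 : (1 : ℝ) ≤ (b : ℝ) ^ 2 := by
      have : 1 ≤ b ^ 2 := Int.one_le_abs (pow_ne_zero 2 hb0) |>.trans_eq (abs_of_nonneg (sq_nonneg b))
      exact_mod_cast this
    refine ⟨d, Finset.mem_Icc.mpr ⟨hd1, Nat.le_floor ?_⟩, hd, p * b, by rw [hsign]; exact heq, ?_⟩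
    · rw [habs] at hFle
      have h1 : (d : ℝ) * y ^ 152 ≤ H * y ^ 48 * y ^ 152 := by
        calc (d : ℝ) * y ^ 152 = d * ((y ^ 76) ^ 2 * 1) := by ring
          _ ≤ d * ((p : ℝ) ^ 2 * (b : ℝ) ^ 2) := by gcongr
          _ ≤ H * y ^ 200 := hFle
          _ = H * y ^ 48 * y ^ 152 := by ring
      exact le_of_mul_le_mul_right h1 (by positivity)
    · have hY0 : (d : ℤ) * (p * b) ≠ 0 := by
        have : (d : ℤ) ≠ 0 := by exact_mod_cast hd.ne_zero
        exact mul_ne_zero this (mul_ne_zero hpZ.ne' hb0)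
      have hYle : |(((d : ℤ) * (p * b) : ℤ) : ℝ)| ≤ H * y ^ 200 := by
        refine le_trans ?_ hFle
        rw [habs]
        push_cast
        rw [abs_mul, abs_of_nonneg (Nat.cast_nonneg d), ← mul_pow]
        gcongr
        have h1 : 1 ≤ |((p : ℝ) * b)| := by
          have : 1 ≤ |(p : ℤ) * b| := Int.one_le_abs (mul_ne_zero hpZ.ne' hb0)
          exact_mod_cast this
        rw [← sq_abs]
        nlinarith
      have h1 := card_filter_dvd_le (fun p hp => (hP p hp).1) hY0
      have h2 := hF200 _ hYle hY0
      have h3 : ((P.filter fun q : ℕ => (q : ℤ) ∣ d * (p * b)).card : ℝ) ≤ C₂ * H * y :=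
        le_trans (by exact_mod_cast h1) h2
      have h4 : 2 * (C₂ * H * y) ≤ y ^ 4 := by
        calc 2 * (C₂ * H * y) ≤ y * y := by nlinarith
          _ = y ^ 2 := by ring
          _ ≤ y ^ 4 := pow_le_pow_right₀ hy1 (by norm_num)
      have h5 : 2 * ((P.filter fun q : ℕ => (q : ℤ) ∣ d * (p * b)).card : ℝ) ≤ P.card := by linarith
      exact_mod_cast h5
  have hpart : ∀ σ : ℤ, σ ^ 2 = 1 →
      ((U.filter fun w => (quinticForm F w.1 w.2).sign = σ).card : ℝ) ≤
        C₁ * (80 * 81 + 60 * (C₂ * H * (18 * (3 * H)))) * y ^ 78 := by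
    intro σ hσ
    have hmem : ∀ w ∈ U.filter (fun w => (quinticForm F w.1 w.2).sign = σ), w ∈ U :=
      fun w hw => (Finset.mem_filter.mp hw).1
    refine (card_small_squarefree_part_le hF hne hX1 hDX hDN hPne hP (κ₁ := C₁ * y)
      (κ₂ := C₂ * H * y) (by positivity) (by positivity) hκ₁ hκ₂ hσ
      (fun w hw => hcop w (hmem w hw)) (fun w hw => hbd w (hmem w hw)) fun w hw => by
        have := hdecomp w (hmem w hw)
        rwa [(Finset.mem_filter.mp hw).2] at this).trans ?_
    rw [hN]
    have hlog0 : 0 ≤ 1 + Real.log D := by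
      have : 0 ≤ Real.log D := Real.log_natCast_nonneg D
      linarith
    -- Exponents of y: 1 + 80 - 4 + 1 = 78 in the first term, and 1 + 12 + 40 + 1 + 24 = 78 in the
    -- second.
    calc C₁ * y * (80 * ((y ^ 40) ^ 2 / P.card * (1 + Real.log D)) +
          60 * (((⌊y ^ 6⌋₊ : ℕ) : ℝ) ^ 2 * y ^ 40 * (C₂ * H * y * (18 * X))))
        ≤ C₁ * y * (80 * ((y ^ 40) ^ 2 / y ^ 4 * (81 * y)) +
          60 * ((y ^ 6) ^ 2 * y ^ 40 * (C₂ * H * y * (18 * (3 * H * y ^ 24))))) := by gcongr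
      _ = _ := by field_simp
  have hsplit : U.card ≤ (U.filter fun w => (quinticForm F w.1 w.2).sign = 1).card +
      (U.filter fun w => (quinticForm F w.1 w.2).sign = -1).card := by
    refine (Finset.card_le_card fun w hw => ?_).trans (Finset.card_union_le _ _)
    rw [Finset.mem_union, Finset.mem_filter, Finset.mem_filter]
    rcases lt_or_gt_of_ne (hFne w hw) with h | h
    · exact Or.inr ⟨hw, Int.sign_eq_neg_one_of_neg h⟩
    · exact Or.inl ⟨hw, Int.sign_eq_one_of_pos h⟩
  have h1 := hpart 1 (by norm_num)
  have h2 := hpart (-1) (by norm_num)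
  have h3 : (U.card : ℝ) ≤ ((U.filter fun w => (quinticForm F w.1 w.2).sign = 1).card : ℝ) +
      ((U.filter fun w => (quinticForm F w.1 w.2).sign = -1).card : ℝ) := by exact_mod_cast hsplit
  linarith

/-! ### Medium primes and conclusion. -/

/-- Few points have a value divisible by the square of a prime of medium size. -/
theorem card_medium_prime_le {F A B : ℤ[X]} {D : ℤ} (hF : F.natDegree = 5)
    (hD : F * A + derivative F * B = C D) (hD0 : D ≠ 0) {N : ℕ} (hDN : D.natAbs ≤ N)
    (hleadN : (F.coeff 5).natAbs ≤ N) (L : ℕ) (U : Finset (ℤ × ℤ))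
    (hcop : ∀ w ∈ U, IsCoprime w.1 w.2) (hbd : ∀ w ∈ U, |w.1| ≤ N ∧ |w.2| ≤ N)
    (hU : ∀ w ∈ U, ∃ p : ℕ, p.Prime ∧ N < p ∧ p ≤ L ∧ (p : ℤ) ^ 2 ∣ quinticForm F w.1 w.2) :
    U.card ≤ L * (9 * ((F.coeff 5).natAbs + 6)) := by
  classical
  have hlead : F.coeff 5 ≠ 0 := by
    rw [← hF]; exact leadingCoeff_ne_zero.mpr (by rintro rfl; simp at hF)
  have hndvd : ∀ (m : ℤ) (p : ℕ), m ≠ 0 → m.natAbs ≤ N → N < p → ¬ (p : ℤ) ∣ m := by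
    intro m p hm hmN hp h
    have := Nat.le_of_dvd (Int.natAbs_pos.mpr hm) (Int.natCast_dvd.mp h)
    omega
  set V : ℕ → Finset (ℤ × ℤ) := fun p =>
    U.filter fun w => (p : ℤ) ^ 2 ∣ quinticForm F w.1 w.2 with hV
  calc U.card ≤ (((Finset.Icc 1 L).filter fun p => p.Prime ∧ N < p).biUnion V).card := by
        refine Finset.card_le_card fun w hw => ?_
        obtain ⟨p, hp, hNp, hpL, h⟩ := hU w hw
        exact Finset.mem_biUnion.mpr ⟨p, Finset.mem_filter.mpr
          ⟨Finset.mem_Icc.mpr ⟨hp.one_le, hpL⟩, hp, hNp⟩, Finset.mem_filter.mpr ⟨hw, h⟩⟩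
    _ ≤ ((Finset.Icc 1 L).filter fun p => p.Prime ∧ N < p).card *
          (9 * ((F.coeff 5).natAbs + 6)) := by
        refine Finset.card_biUnion_le_card_mul _ _ _ fun p hp => ?_
        obtain ⟨-, hp, hNp⟩ := Finset.mem_filter.mp hp
        exact card_sq_dvd_le hF hD hp (hndvd D p hD0 hDN hNp) (hndvd _ p hlead hleadN hNp) hNp _
          (fun w hw => hcop w (Finset.mem_filter.mp hw).1)
          (fun w hw => hbd w (Finset.mem_filter.mp hw).1)
          (fun w hw => (Finset.mem_filter.mp hw).2)
    _ ≤ _ := by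
        refine Nat.mul_le_mul_right _ ((Finset.card_filter_le _ _).trans ?_)
        simp

theorem largeSquareDivisorCount_le (f : MvPolynomial (Fin 2) ℤ) (N : ℕ) :
    largeSquareDivisorCount f N ≤ (2 * N + 1) ^ 2 := by
  have h1 : largeSquareDivisorPairs f N ⊆
      ((Finset.Icc (-(N : ℤ)) N ×ˢ Finset.Icc (-(N : ℤ)) N : Finset (ℤ × ℤ)) : Set (ℤ × ℤ)) := by
    rintro ⟨x, z⟩ ⟨hx, hz, -⟩
    simpa only [Finset.mem_coe, Finset.mem_product, Finset.mem_Icc] using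
      ⟨abs_le.mp hx, abs_le.mp hz⟩
  refine (Set.ncard_le_ncard h1 (Finset.finite_toSet _)).trans ?_
  rw [Set.ncard_coe_finset, Finset.card_product, Int.card_Icc, sq]
  have : ((N : ℤ) + 1 - -(N : ℤ)).toNat = 2 * N + 1 := by omega
  rw [this]

/-- The primes are split at y^76 = N^(19/10), where y = N^(1/40). The medium range gives O(y^76),
the rest O(y^78) = O(N^(39/20)). -/
theorem exists_eventually_largeSquareDivisorCount_le (f : MvPolynomial (Fin 2) ℤ)
    (hf : f.IsHomogeneous 5) (hirr : Irreducible (MvPolynomial.map (Int.castRingHom ℚ) f)) :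
    ∃ C : ℝ, ∀ᶠ N : ℕ in Filter.atTop,
      (largeSquareDivisorCount f N : ℝ) ≤ C * (N : ℝ) ^ (39 / 20 : ℝ) := by
  classical
  obtain ⟨F, hF, hFirr, hfF⟩ := exists_irreducible_quintic f hf hirr
  obtain ⟨D, hD0, A, B, hD⟩ := exists_bezout_derivative hF hFirr
  obtain ⟨C, hC⟩ := exists_eventually_card_huge_prime_le hF
    (fun x z h => quinticForm_ne_zero hF hFirr h)
  set K : ℕ := 9 * ((F.coeff 5).natAbs + 6) with hK
  refine ⟨K + C, ?_⟩
  have htend : Filter.Tendsto (fun N : ℕ => (N : ℝ) ^ (1 / 40 : ℝ)) Filter.atTop Filter.atTop :=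
    (tendsto_rpow_atTop (by norm_num)).comp tendsto_natCast_atTop_atTop
  filter_upwards [htend.eventually hC, Filter.eventually_ge_atTop D.natAbs,
    Filter.eventually_ge_atTop (F.coeff 5).natAbs, Filter.eventually_ge_atTop 1]
    with N hN hND hN5 hN1
  set y := (N : ℝ) ^ (1 / 40 : ℝ) with hy
  have hN0 : (1 : ℝ) ≤ N := by exact_mod_cast hN1
  have hy1 : 1 ≤ y := Real.one_le_rpow hN0 (by norm_num)
  have hyN : (N : ℝ) = y ^ 40 := by
    rw [hy, ← Real.rpow_natCast, ← Real.rpow_mul (by positivity)]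
    norm_num
  have hyN' : (N : ℝ) ^ (39 / 20 : ℝ) = y ^ 78 := by
    rw [hy, ← Real.rpow_natCast, ← Real.rpow_mul (by positivity)]
    norm_num
  set T := (largeSquareDivisorPairs_finite f N).toFinset with hT
  have hcard : largeSquareDivisorCount f N = T.card :=
    Set.ncard_eq_toFinset_card _ (largeSquareDivisorPairs_finite f N)
  have hTmem : ∀ w ∈ T, |w.1| ≤ (N : ℤ) ∧ |w.2| ≤ (N : ℤ) ∧ IsCoprime w.1 w.2 ∧
      ∃ p : ℕ, p.Prime ∧ N < p ∧ (p : ℤ) ^ 2 ∣ quinticForm F w.1 w.2 := by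
    intro w hw
    obtain ⟨h1, h2, h3, p, hp, hNp, h4⟩ := (Set.Finite.mem_toFinset _).mp hw
    rw [hfF] at h4
    exact ⟨h1, h2, Int.isCoprime_iff_gcd_eq_one.mpr h3, p, hp, hNp, h4⟩
  set U := T.filter fun w => ∃ p : ℕ, y ^ 76 < p ∧ (p : ℤ) ^ 2 ∣ quinticForm F w.1 w.2 with hU
  set V := T.filter fun w => ¬ ∃ p : ℕ, y ^ 76 < p ∧ (p : ℤ) ^ 2 ∣ quinticForm F w.1 w.2 with hV
  have hUV : U.card + V.card = T.card := Finset.card_filter_add_card_filter_not _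
  have hUT : ∀ w ∈ U, w ∈ T := fun w hw => (Finset.mem_filter.mp hw).1
  have hVT : ∀ w ∈ V, w ∈ T := fun w hw => (Finset.mem_filter.mp hw).1
  have h1 : (U.card : ℝ) ≤ C * y ^ 78 := hN N hyN U (fun w hw => (hTmem w (hUT w hw)).2.2.1)
    (fun w hw => ⟨(hTmem w (hUT w hw)).1, (hTmem w (hUT w hw)).2.1⟩)
    (fun w hw => (Finset.mem_filter.mp hw).2)
  have h2 : V.card ≤ ⌊y ^ 76⌋₊ * K := by
    refine card_medium_prime_le hF hD hD0 hND hN5 _ V (fun w hw => (hTmem w (hVT w hw)).2.2.1)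
      (fun w hw => ⟨(hTmem w (hVT w hw)).1, (hTmem w (hVT w hw)).2.1⟩) fun w hw => ?_
    obtain ⟨-, -, -, p, hp, hNp, h⟩ := hTmem w (hVT w hw)
    refine ⟨p, hp, hNp, Nat.le_floor ?_, h⟩
    by_contra! hlt
    exact (Finset.mem_filter.mp hw).2 ⟨p, hlt, h⟩
  have h3 : (V.card : ℝ) ≤ K * y ^ 78 := by
    calc (V.card : ℝ) ≤ (⌊y ^ 76⌋₊ : ℝ) * K := by exact_mod_cast h2
      _ ≤ y ^ 76 * K := by
        gcongr; exact Nat.floor_le (by positivity)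
      _ ≤ y ^ 78 * K := by gcongr; norm_num
      _ = K * y ^ 78 := mul_comm _ _
  rw [hcard, hyN', ← hUV]
  push_cast
  linarith

theorem mainTheorem12 (f : MvPolynomial (Fin 2) ℤ) (hf : f.IsHomogeneous 5)
    (hirr : Irreducible (MvPolynomial.map (Int.castRingHom ℚ) f)) (ε : ℝ) (hε : 0 < ε) :
    ∃ C : ℝ, ∀ N : ℕ, 1 ≤ N →
      (largeSquareDivisorCount f N : ℝ) ≤ C * (N : ℝ) ^ ((5 + Real.sqrt 113) / 8 + ε) := by
  obtain ⟨C, hC⟩ := exists_eventually_largeSquareDivisorCount_le f hf hirr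
  obtain ⟨N₀, hN₀⟩ := Filter.eventually_atTop.mp hC
  -- Since (53/5)² = 112.36 < 113, the target exponent is at least (5 + 53/5)/8 = 39/20.
  have hexp : (39 / 20 : ℝ) ≤ (5 + Real.sqrt 113) / 8 + ε := by
    have : (53 / 5 : ℝ) ≤ Real.sqrt 113 := Real.le_sqrt_of_sq_le (by norm_num)
    linarith
  -- The second entry covers N ≤ N₀ by counting the whole box.
  refine ⟨max C ((2 * N₀ + 1) ^ 2), fun N hN => ?_⟩
  have hN1 : (1 : ℝ) ≤ N := by exact_mod_cast hN
  have hmax : 0 ≤ max C ((2 * N₀ + 1 : ℝ) ^ 2) := le_max_of_le_right (by positivity)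
  rcases le_total N₀ N with h | h
  · calc (largeSquareDivisorCount f N : ℝ) ≤ C * (N : ℝ) ^ (39 / 20 : ℝ) := hN₀ N h
      _ ≤ max C ((2 * N₀ + 1) ^ 2) * (N : ℝ) ^ (39 / 20 : ℝ) := by
        gcongr; exact le_max_left _ _
      _ ≤ _ := by gcongr
  · calc (largeSquareDivisorCount f N : ℝ) ≤ (2 * N + 1 : ℝ) ^ 2 := by
          exact_mod_cast largeSquareDivisorCount_le f N
      _ ≤ (2 * N₀ + 1 : ℝ) ^ 2 := by gcongr
      _ ≤ max C ((2 * N₀ + 1) ^ 2) * 1 := by rw [mul_one]; exact le_max_right _ _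
      _ ≤ _ := by
        gcongr
        exact Real.one_le_rpow hN1 (by linarith)
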